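/- A single item is sold to finitely many bidders whose values $v_i$ are independent, $v_i\sim F_i$, where each $F_i$ is a known continuous (atomless) probability distribution on a bounded interval $[0,B]$; no regularity is assumed. A lookahead auction with pooling (LAP) raises a cutoff price $c$ from $0$, uniformly for all bidders, and a bidder drops when $c$ exceeds her value. As long as at least two bidders are active, the price may rise continuously or jump from $c^o$ to some $c^+>c^o$ (pooling the values in $[c^o,c^+)$), where these choices depend only on the public history. Let $p_i(c)\ge c$ denote a price $r\ge c$ that maximizes $r\cdot\Pr[v_i\ge r\mid v_i\ge c]$. If a single bidder $i$ is left when the price is at $c$ in a continuous phase (or at the start), she is offered the item at price $p_i(c)$. If all $k\ge2$ bidders active at $c^o$ drop in a jump from $c^o$ to $c^+$, the item is sold to a uniformly random one of them at price $c^o$. If exactly one of them, $i$, survives the jump, she chooses between the item for sure at price $\frac1k c^o+\frac{k-1}{k}\,p_i(c^+)$, and the item with probability $\frac1k$ at expected payment $\frac1k c^o$; nobody else gets the item. If at least two survive, the auction continues from $c^+$. Theorem. For every such instance, with any number of bidders, there is an LAP auction whose expected revenue is at least $\frac47$ of the optimal revenue, i.e. at least $\frac47\,\mathbb E\big[\sum_i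 p_i(v)\big]$ for every dominant-strategy incentive compatible and (ex-post) individually rational single-item mechanism $(x,p)$ with allocation probabilities $x_i(v)$ and payments $p_i(v)$. -/

import Mathlib

open MeasureTheory

/-- A sealed-bid single-item mechanism: from the profile of bids, the probability `alloc b i` with
which bidder `i` gets the item and the expected payment `pay b i` of bidder `i`. -/
structure DirectMechanism (ι : Type*) where
  alloc : (ι → ℝ) → ι → ℝ
  pay : (ι → ℝ) → ι → ℝ

/-- Valuation profiles with all values in `[0, B]`. -/
def valueBox (ι : Type*) (B : ℝ) : Set (ι → ℝ) := {v | ∀ i, v i ∈ Set.Icc 0 B}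

namespace DirectMechanism

variable {ι : Type*}

/-- At most one item is sold. -/
def IsFeasible [Fintype ι] (M : DirectMechanism ι) (B : ℝ) : Prop :=
  ∀ v ∈ valueBox ι B, (∀ i, 0 ≤ M.alloc v i) ∧ ∑ i, M.alloc v i ≤ 1

/-- Dominant-strategy incentive compatibility. -/
def IsDSIC [DecidableEq ι] (M : DirectMechanism ι) (B : ℝ) : Prop :=
  ∀ v ∈ valueBox ι B, ∀ i, ∀ b ∈ Set.Icc 0 B,
    v i * M.alloc (Function.update v i b) i - M.pay (Function.update v i b) i
      ≤ v i * M.alloc v i - M.pay v i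

/-- (Ex-post) individual rationality. -/
def IsIR (M : DirectMechanism ι) (B : ℝ) : Prop :=
  ∀ v ∈ valueBox ι B, ∀ i, 0 ≤ v i * M.alloc v i - M.pay v i

/-- The payments collected by the seller at the value profile `v`. -/
def totalPayment [Fintype ι] (M : DirectMechanism ι) (v : ι → ℝ) : ℝ :=
  ∑ i, M.pay v i

/-- Expected revenue when the values are independent, `v i` with law `F i`, and the bidders bid
their values. -/
noncomputable def revenue [Fintype ι] (M : DirectMechanism ι) (F : ι → Measure ℝ) : ℝ :=
  ∫ v, M.totalPayment v ∂(Measure.pi F)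

/-- The mechanisms over which the optimal revenue is taken. Payments may be negative, so that the
expected revenue may be `-∞`; such mechanisms are left out by the integrability condition. -/
structure IsTruthful [Fintype ι] [DecidableEq ι] (M : DirectMechanism ι) (F : ι → Measure ℝ)
    (B : ℝ) : Prop where
  measurable_alloc : Measurable M.alloc
  measurable_pay : Measurable M.pay
  integrable : Integrable M.totalPayment (Measure.pi F)
  feasible : M.IsFeasible B
  dsic : M.IsDSIC B
  ir : M.IsIR B

end DirectMechanism

/-- A plan for raising the cutoff price from `c` on: each `I ∈ jumps` is a discrete jump from
`I.1` to `I.2` (all values in `[I.1, I.2)` are pooled), and outside of the pooled intervals the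
cutoff price rises continuously. The condition `wf` says that from any moment on there is a next
jump, unless no jump is left. -/
structure RaisePlan (c : ℝ) where
  jumps : Set (ℝ × ℝ)
  le_start : ∀ I ∈ jumps, c ≤ I.1
  start_lt : ∀ I ∈ jumps, I.1 < I.2
  disjoint : jumps.PairwiseDisjoint fun I => Set.Ico I.1 I.2
  wf : (Prod.fst '' jumps).IsWF

/-- What is publicly known about the past, most recent item first: an entry `(S, a, b)` records
that `S` was the set of active bidders left after the cutoff price was raised from `a` to `b` and
some bidder dropped; `a = b` means that the price was rising continuously through `a`. -/
abbrev AuctionHistory (ι : Type*) := List (Finset ι × ℝ × ℝ)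

/-- `p` is a take-it-or-leave-it price `p ≥ c` that maximizes the expected revenue from a bidder
with value distribution `μ` whose value is known to be at least `c`. -/
def IsOptimalPrice (μ : Measure ℝ) (c p : ℝ) : Prop :=
  c ≤ p ∧ ∀ r, c ≤ r →
    r * (ProbabilityTheory.cond μ (Set.Ici c)).real (Set.Ici r)
      ≤ p * (ProbabilityTheory.cond μ (Set.Ici c)).real (Set.Ici p)

/-- A lookahead auction with pooling for independent values with laws `F i`. After each drop, the
seller plans the further increase of the cutoff price given the history `h`, the set `S` of
active bidders and the current cutoff price `c`; the plan is followed until somebody drops.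
`price i c` is the final price for bidder `i` if she is the last one left at cutoff price `c`. -/
structure LAP {ι : Type*} (F : ι → Measure ℝ) where
  plan : (h : AuctionHistory ι) → (S : Finset ι) → (c : ℝ) → RaisePlan c
  price : ι → ℝ → ℝ
  price_optimal : ∀ i c, 0 ≤ c → IsOptimalPrice (F i) c (price i c)

/-- The allocation probabilities and the expected payments at the end of an auction. -/
structure AuctionOutcome (ι : Type*) where
  alloc : ι → ℝ
  pay : ι → ℝ

namespace AuctionOutcome

variable {ι : Type*} [DecidableEq ι]

/-- The item is not sold. -/
def unsold (ι : Type*) : AuctionOutcome ι := ⟨fun _ => 0, fun _ => 0⟩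

/-- Bidder `i` gets the item with probability `q` and pays `p` in expectation. -/
def single (i : ι) (q p : ℝ) : AuctionOutcome ι := ⟨Pi.single i q, Pi.single i p⟩

/-- Bidder `i` with value `x` is offered the item for the price `p`. -/
noncomputable def postedPrice (i : ι) (x p : ℝ) : AuctionOutcome ι :=
  if p ≤ x then single i 1 p else unsold ι

/-- The item is sold at price `a` to a uniformly random bidder in `S`. -/
noncomputable def lottery (S : Finset ι) (a : ℝ) : AuctionOutcome ι :=
  ⟨fun i => if i ∈ S then 1 / (S.card : ℝ) else 0,
   fun i => if i ∈ S then 1 / (S.card : ℝ) * a else 0⟩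

/-- Bidder `i` with value `x` is the only one to survive a jump from `a`, where `k` bidders were
active. She chooses between the item for sure at the expected price `a / k + (k - 1) / k * r`, and
a chance of `1 / k` of getting the item at price `a`. For `k ≥ 2` the first
option is at least as good for her if and only if `r ≤ x`. -/
noncomputable def menu (i : ι) (x : ℝ) (k : ℕ) (a r : ℝ) : AuctionOutcome ι :=
  if r ≤ x then single i 1 (1 / (k : ℝ) * a + ((k : ℝ) - 1) / (k : ℝ) * r)
  else single i (1 / (k : ℝ)) (1 / (k : ℝ) * a)

end AuctionOutcome

namespace LAP

variable {ι : Type*}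

/-- Bidders in `S` whose value is at least `b`. -/
noncomputable def atLeast (v : ι → ℝ) (S : Finset ι) (b : ℝ) : Finset ι :=
  S.filter fun i => b ≤ v i

/-- Bidders in `S` whose value is larger than `b`. -/
noncomputable def above (v : ι → ℝ) (S : Finset ι) (b : ℝ) : Finset ι :=
  S.filter fun i => b < v i

theorem atLeast_ssubset (v : ι → ℝ) (S : Finset ι) (hS : S.Nonempty) (b : ℝ)
    (hb : S.inf' hS v < b) : atLeast v S b ⊂ S := by
  obtain ⟨i, hi, him⟩ := S.exists_mem_eq_inf' hS v
  exact Finset.filter_ssubset.mpr ⟨i, hi, not_le.mpr (him ▸ hb)⟩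

theorem above_ssubset (v : ι → ℝ) (S : Finset ι) (hS : S.Nonempty) :
    above v S (S.inf' hS v) ⊂ S := by
  obtain ⟨i, hi, him⟩ := S.exists_mem_eq_inf' hS v
  exact Finset.filter_ssubset.mpr ⟨i, hi, not_lt.mpr him.symm.le⟩

open Classical in
/-- The auction with value profile `v`, from the moment at which the history is `h`, the active
bidders are those in `S`, and the cutoff price is `c`. The lowest value `m` of an active bidder
determines the next drop. It happens in the jump whose pooled interval contains `m`, if there is
one; otherwise the cutoff price rises continuously through `m`. -/
noncomputable def run [DecidableEq ι] {F : ι → Measure ℝ} (A : LAP F) (v : ι → ℝ) (h : AuctionHistory ι)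
    (S : Finset ι) (c : ℝ) : AuctionOutcome ι :=
  if hS : 2 ≤ S.card then
    let m := S.inf' (Finset.card_pos.mp (by omega)) v
    if hJ : ∃ I ∈ (A.plan h S c).jumps, m ∈ Set.Ico I.1 I.2 then
      let a := hJ.choose.1
      let b := hJ.choose.2
      if atLeast v S b = ∅ then AuctionOutcome.lottery S a
      else if h1 : ∃ i, atLeast v S b = {i} then
        AuctionOutcome.menu h1.choose (v h1.choose) S.card a (A.price h1.choose b)
      else run A v ((atLeast v S b, a, b) :: h) (atLeast v S b) b
    else run A v ((above v S m, m, m) :: h) (above v S m) m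
  else if h1 : ∃ i, S = {i} then
    AuctionOutcome.postedPrice h1.choose (v h1.choose) (A.price h1.choose c)
  else AuctionOutcome.unsold ι
termination_by S.card
decreasing_by
  · exact Finset.card_lt_card (atLeast_ssubset v S (Finset.card_pos.mp (by omega)) _ hJ.choose_spec.2.2)
  · exact Finset.card_lt_card (above_ssubset v S (Finset.card_pos.mp (by omega)))

/-- The auction as a direct mechanism: the cutoff price starts at `0`. -/
noncomputable def toMechanism [Fintype ι] [DecidableEq ι] {F : ι → Measure ℝ} (A : LAP F) :
    DirectMechanism ι where
  alloc v := (A.run v [] (atLeast v Finset.univ 0) 0).alloc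
  pay v := (A.run v [] (atLeast v Finset.univ 0) 0).pay

end LAP

/-!
A lookahead auction loses revenue for one reason: when a single bidder `i` is left at the cutoff
price `c`, the optimal mechanism may collect `c` from somebody else whenever it does not sell to `i`
above `c`, while the auction only gets the optimal revenue `R` from `i` (conditional on her value
being at least `c`). If `u` is the optimal expected surplus over `c` from bidder `i`, the optimal
mechanism gets at most `c + u`, and all is well as long as `c + u ≤ 7 / 4 * R`. Otherwise `c` is
called *risky* for `i` (`riskyPrices`); in this case `3 / 4 * c ≤ u`, and `i` reaches the
surplus-maximizing price with conditional probability at most `1 / 4`.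

The auction raises the price continuously until two bidders are left, and further until the price
`c` becomes risky for one of them (`firstRisky`). If a bidder drops before, the last one is left
at a price that is not risky for her. Otherwise let `i` be a bidder for whom `c` is risky, let `j` be the
other one, let `P`, `P'` be their surplus-maximizing prices, and let `u`, `u'` be the surpluses. The
optimal revenue is now at most `c + u + u'` (`excessBound`). Pooling `[c, P)` gives at least
`c + u / 2`. Letting the price rise to `min P P'` and pooling up to `max P P'` gives at least
`P q + P' q' - (P q q' + P' q' q) / 2`, where `q`, `q'` are the probabilities that the values reach
`P`, `P'`. One of these two options always gives `4 / 7` of the bound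
(`four_sevenths_le_of_risky`), and the auction takes it (`riskyPool`).

The upper bounds come from a single fact about one bidder
(`integral_Ioi_le_of_forall_threshold`): in a truthful mechanism the payment minus `c` times the
allocation probability is, above `c`, at most a mixture of the surpluses of posted prices. No
virtual values are needed. The lower bounds are integrals of the explicit payments
(`poolingBound_le`). Both are compared conditionally on the values of all bidders but the
two highest ones (`integral_totalPayment_le_twoBidderRevenue`) and then integrated, by resampling
the values of these two bidders (`integral_pi_eq_updatePair`).
-/

set_option linter.unusedSectionVars false

/-! ### Survival functions and revenue curves of a single bidder -/

/-- The probability that a value with law `μ` is at least `p`. -/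
noncomputable def survival (μ : Measure ℝ) (p : ℝ) : ℝ := μ.real (Set.Ici p)

theorem survival_nonneg (μ : Measure ℝ) (p : ℝ) : 0 ≤ survival μ p := measureReal_nonneg

theorem survival_le_one (μ : Measure ℝ) [IsProbabilityMeasure μ] (p : ℝ) : survival μ p ≤ 1 :=
  measureReal_le_one

theorem survival_antitone (μ : Measure ℝ) [IsProbabilityMeasure μ] : Antitone (survival μ) :=
  fun _ _ h => measureReal_mono (Set.Ici_subset_Ici.mpr h)

theorem continuous_survival (μ : Measure ℝ) [IsProbabilityMeasure μ] [NullSingletonClass μ] :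
    Continuous (survival μ) := by
  have h : survival μ = fun p => ∫ x, (Set.Ici p).indicator (fun _ => (1 : ℝ)) x ∂μ := by
    funext p
    rw [integral_indicator_const _ measurableSet_Ici]
    simp [survival]
  rw [h, continuous_iff_continuousAt]
  intro p
  refine continuousAt_of_dominated (bound := fun _ => 1) ?_ ?_ (integrable_const _) ?_
  · exact Filter.Eventually.of_forall fun q =>
      (measurable_const.indicator measurableSet_Ici).aestronglyMeasurable
  · refine Filter.Eventually.of_forall fun q => Filter.Eventually.of_forall fun x => ?_
    rw [Set.indicator_apply]
    split_ifs <;> simp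
  · have hne : ∀ᵐ x ∂μ, x ≠ p := by
      rw [ae_iff]
      simp
    filter_upwards [hne] with x hx
    rcases lt_or_gt_of_ne hx with h | h
    · refine ContinuousAt.congr (f := fun _ => (0 : ℝ)) continuousAt_const ?_
      filter_upwards [lt_mem_nhds h] with q hq
      rw [Set.indicator_of_notMem (by simpa using hq)]
    · refine ContinuousAt.congr (f := fun _ => (1 : ℝ)) continuousAt_const ?_
      filter_upwards [gt_mem_nhds h] with q hq
      rw [Set.indicator_of_mem (by simpa using hq.le)]

theorem measureReal_Ioi_eq_survival (μ : Measure ℝ) [NullSingletonClass μ] (p : ℝ) :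
    μ.real (Set.Ioi p) = survival μ p := by
  rw [survival, measureReal_def, measureReal_def, measure_congr Ioi_ae_eq_Ici]

theorem measureReal_Ico_eq_survival (μ : Measure ℝ) [IsProbabilityMeasure μ] {a b : ℝ}
    (h : a ≤ b) : μ.real (Set.Ico a b) = survival μ a - survival μ b := by
  rw [survival, survival, ← measureReal_sdiff (Set.Ici_subset_Ici.mpr h) measurableSet_Ici,
    Set.Ici_sdiff_Ici]

theorem survival_eq_zero {μ : Measure ℝ} [NullSingletonClass μ] {B : ℝ}
    (hμ : μ (Set.Icc 0 B)ᶜ = 0) {p : ℝ}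
    (hp : B ≤ p) : survival μ p = 0 := by
  rw [← measureReal_Ioi_eq_survival, measureReal_def, measure_mono_null _ hμ, ENNReal.toReal_zero]
  intro x hx hx'
  exact absurd (lt_of_le_of_lt hp hx) (not_lt.mpr hx'.2)

theorem survival_zero {μ : Measure ℝ} [IsProbabilityMeasure μ] {B : ℝ}
    (hμ : μ (Set.Icc 0 B)ᶜ = 0) : survival μ 0 = 1 := by
  have h : μ (Set.Ici 0)ᶜ = 0 := measure_mono_null (Set.compl_subset_compl.mpr fun x hx => hx.1) hμ
  rw [survival, measureReal_def, (prob_compl_eq_zero_iff measurableSet_Ici).mp h]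
  simp

theorem nonneg_of_support {μ : Measure ℝ} [IsProbabilityMeasure μ] {B : ℝ}
    (hμ : μ (Set.Icc 0 B)ᶜ = 0) : 0 ≤ B := by
  by_contra h
  rw [Set.Icc_eq_empty h, Set.compl_empty, measure_univ] at hμ
  exact one_ne_zero hμ

theorem ae_mem_Icc {μ : Measure ℝ} {B : ℝ} (hμ : μ (Set.Icc 0 B)ᶜ = 0) :
    ∀ᵐ x ∂μ, x ∈ Set.Icc 0 B := hμ

/-- The smallest price `p ≥ c` that maximizes the expected surplus `(p - d) * Pr[v ≥ p]` of a
seller with opportunity cost `d`. -/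
noncomputable def bestPrice (μ : Measure ℝ) (d c : ℝ) : ℝ :=
  sInf {p | c ≤ p ∧ ∀ r, c ≤ r → (r - d) * survival μ r ≤ (p - d) * survival μ p}

/-- `Pr[v ≥ c]` times the optimal revenue from a bidder known to have a value of at least `c`. -/
noncomputable def topRevenue (μ : Measure ℝ) (c : ℝ) : ℝ :=
  bestPrice μ 0 c * survival μ (bestPrice μ 0 c)

/-- `Pr[v ≥ c]` times the optimal surplus over `c` of a seller who can also get `c` elsewhere,
from a bidder known to have a value of at least `c`. -/
noncomputable def topExcess (μ : Measure ℝ) (c : ℝ) : ℝ :=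
  (bestPrice μ c c - c) * survival μ (bestPrice μ c c)

section

variable {μ : Measure ℝ} [IsProbabilityMeasure μ] [NullSingletonClass μ] {B : ℝ}

theorem bestPrice_mem (hμ : μ (Set.Icc 0 B)ᶜ = 0) {d c : ℝ} (hdc : d ≤ c) :
    c ≤ bestPrice μ d c ∧ ∀ r, c ≤ r →
      (r - d) * survival μ r ≤ (bestPrice μ d c - d) * survival μ (bestPrice μ d c) := by
  have hc := continuous_survival μ
  have hcont : Continuous fun p => (p - d) * survival μ p := by fun_prop
  set s := {p | c ≤ p ∧ ∀ r, c ≤ r → (r - d) * survival μ r ≤ (p - d) * survival μ p} with hs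
  have hclosed : IsClosed s := by
    have : s = Set.Ici c ∩ ⋂ r : Set.Ici c,
        {p | (r.1 - d) * survival μ r.1 ≤ (p - d) * survival μ p} := by
      ext p
      simp [hs]
    rw [this]
    exact isClosed_Ici.inter (isClosed_iInter fun r => isClosed_le continuous_const hcont)
  have hne : s.Nonempty := by
    obtain ⟨p, hp, hmax⟩ := (isCompact_Icc (a := c) (b := max B c)).exists_isMaxOn
      ⟨c, le_rfl, le_max_right _ _⟩ hcont.continuousOn
    refine ⟨p, hp.1, fun r hr => ?_⟩
    rcases le_total r (max B c) with h | h
    · exact hmax ⟨hr, h⟩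
    · rw [survival_eq_zero hμ ((le_max_left _ _).trans h), mul_zero]
      exact mul_nonneg (by linarith [hp.1]) (survival_nonneg _ _)
  exact hclosed.csInf_mem hne ⟨c, fun p hp => hp.1⟩

theorem le_bestPrice (hμ : μ (Set.Icc 0 B)ᶜ = 0) {d c : ℝ} (hdc : d ≤ c) :
    c ≤ bestPrice μ d c := (bestPrice_mem hμ hdc).1

theorem bestPrice_max (hμ : μ (Set.Icc 0 B)ᶜ = 0) {d c r : ℝ} (hdc : d ≤ c) (hr : c ≤ r) :
    (r - d) * survival μ r ≤ (bestPrice μ d c - d) * survival μ (bestPrice μ d c) :=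
  (bestPrice_mem hμ hdc).2 r hr

/-- Because the smallest maximizer is chosen, the price is monotone in the lower bound on the
value and in the opportunity cost. -/
theorem bestPrice_mono (hμ : μ (Set.Icc 0 B)ᶜ = 0) {d d' c c' : ℝ} (hdc : d ≤ c) (hdc' : d' ≤ c')
    (hd : d ≤ d') (hc : c ≤ c') : bestPrice μ d c ≤ bestPrice μ d' c' := by
  have h' := bestPrice_mem hμ hdc'
  rcases le_total (bestPrice μ d c) c' with h | h
  · exact h.trans h'.1
  · by_contra! hlt
    set p := bestPrice μ d c
    set p' := bestPrice μ d' c'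
    have hp := bestPrice_mem hμ hdc
    have hs : survival μ p ≤ survival μ p' := survival_antitone μ hlt.le
    have h1 := h'.2 p h
    -- Then `p'` is a maximizer for `(d, c)` as well, and it is smaller than the smallest one.
    have hmem : p' ∈
        {p | c ≤ p ∧ ∀ r, c ≤ r → (r - d) * survival μ r ≤ (p - d) * survival μ p} := by
      refine ⟨hc.trans h'.1, fun r hr => (hp.2 r hr).trans ?_⟩
      nlinarith [mul_nonneg (sub_nonneg.mpr hd) (sub_nonneg.mpr hs)]
    exact absurd (csInf_le ⟨c, fun q hq => hq.1⟩ hmem) (not_le.mpr hlt)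

theorem mul_survival_le_topRevenue (hμ : μ (Set.Icc 0 B)ᶜ = 0) {c r : ℝ} (hc : 0 ≤ c)
    (hr : c ≤ r) : r * survival μ r ≤ topRevenue μ c := by
  simpa [topRevenue] using bestPrice_max hμ hc hr

theorem sub_mul_survival_le_topExcess (hμ : μ (Set.Icc 0 B)ᶜ = 0) {c r : ℝ}
    (hr : c ≤ r) : (r - c) * survival μ r ≤ topExcess μ c :=
  bestPrice_max hμ le_rfl hr

theorem topExcess_nonneg (hμ : μ (Set.Icc 0 B)ᶜ = 0) (c : ℝ) : 0 ≤ topExcess μ c := by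
  simpa using sub_mul_survival_le_topExcess hμ (le_refl c)

theorem topRevenue_nonneg (hμ : μ (Set.Icc 0 B)ᶜ = 0) {c : ℝ} (hc : 0 ≤ c) :
    0 ≤ topRevenue μ c :=
  (mul_nonneg hc (survival_nonneg μ c)).trans (mul_survival_le_topRevenue hμ hc le_rfl)

theorem topRevenue_antitoneOn (hμ : μ (Set.Icc 0 B)ᶜ = 0) :
    AntitoneOn (topRevenue μ) (Set.Ici 0) := by
  intro c hc c' hc' h
  exact mul_survival_le_topRevenue hμ hc (h.trans (le_bestPrice hμ hc'))

theorem topExcess_add_le_topRevenue (hμ : μ (Set.Icc 0 B)ᶜ = 0) {c : ℝ} (hc : 0 ≤ c) :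
    topExcess μ c + c * survival μ (bestPrice μ c c) ≤ topRevenue μ c := by
  have := mul_survival_le_topRevenue hμ hc (le_bestPrice hμ (le_refl c))
  unfold topExcess
  linarith

theorem topExcess_le_topRevenue (hμ : μ (Set.Icc 0 B)ᶜ = 0) {c : ℝ} (hc : 0 ≤ c) :
    topExcess μ c ≤ topRevenue μ c := by
  have := topExcess_add_le_topRevenue hμ hc
  have := mul_nonneg hc (survival_nonneg μ (bestPrice μ c c))
  linarith

theorem topExcess_eq_zero (hμ : μ (Set.Icc 0 B)ᶜ = 0) {c : ℝ} (h : survival μ c = 0) :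
    topExcess μ c = 0 := by
  have h1 := survival_antitone μ (le_bestPrice hμ (le_refl c))
  rw [topExcess, le_antisymm (h1.trans h.le) (survival_nonneg _ _), mul_zero]

theorem continuous_topExcess (hμ : μ (Set.Icc 0 B)ᶜ = 0) : Continuous (topExcess μ) := by
  have key : ∀ c c', topExcess μ c ≤ topExcess μ c' + |c - c'| := by
    intro c c'
    have hp := le_bestPrice hμ (le_refl c)
    have hs1 := survival_le_one μ (bestPrice μ c c)
    have hs0 := survival_nonneg μ (bestPrice μ c c)
    have h1 := neg_abs_le (c - c')
    have h2 := abs_nonneg (c - c')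
    have h0 := topExcess_nonneg hμ c'
    rcases le_total c' (bestPrice μ c c) with h | h
    · have := sub_mul_survival_le_topExcess hμ h
      unfold topExcess at this ⊢
      nlinarith
    · have : topExcess μ c ≤ bestPrice μ c c - c := by
        unfold topExcess
        nlinarith
      linarith
  refine (LipschitzWith.of_le_add_mul 1 fun c c' => ?_).continuous
  simpa [Real.dist_eq] using key c c'

theorem monotone_bestPrice_self (hμ : μ (Set.Icc 0 B)ᶜ = 0) :
    Monotone fun c => bestPrice μ c c :=
  fun _ _ h => bestPrice_mono hμ le_rfl le_rfl h h

theorem isOptimalPrice_bestPrice (hμ : μ (Set.Icc 0 B)ᶜ = 0) {c : ℝ} (hc : 0 ≤ c) :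
    IsOptimalPrice μ c (bestPrice μ 0 c) := by
  have h := bestPrice_mem hμ hc
  have hcond : ∀ r, c ≤ r → (ProbabilityTheory.cond μ (Set.Ici c)).real (Set.Ici r)
      = (μ.real (Set.Ici c))⁻¹ * survival μ r := by
    intro r hr
    rw [measureReal_def, ProbabilityTheory.cond_apply measurableSet_Ici,
      Set.inter_eq_right.mpr (Set.Ici_subset_Ici.mpr hr), ENNReal.toReal_mul, ENNReal.toReal_inv,
      ← measureReal_def, ← measureReal_def, survival]
  refine ⟨h.1, fun r hr => ?_⟩
  rw [hcond r hr, hcond _ h.1, mul_left_comm, mul_left_comm (bestPrice μ 0 c)]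
  refine mul_le_mul_of_nonneg_left ?_ (inv_nonneg.mpr measureReal_nonneg)
  simpa using h.2 r hr

end

/-- The cutoff prices `c` at which it is risky for the seller to be left with this bidder alone:
selling to her at the best price then yields at most `4 / 7` of the upper bound
`c * Pr[v ≥ c] + topExcess μ c` on the optimal revenue. The condition is spelled out in terms of all
prices `c + t`, which makes this set visibly closed. -/
def riskyPrices (μ : Measure ℝ) : Set ℝ :=
  {c | ∀ t, 0 ≤ t → 7 / 4 * ((c + t) * survival μ (c + t)) ≤ c * survival μ c + topExcess μ c}

section

variable {μ : Measure ℝ} [IsProbabilityMeasure μ] [NullSingletonClass μ] {B : ℝ}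

theorem isClosed_riskyPrices (hμ : μ (Set.Icc 0 B)ᶜ = 0) : IsClosed (riskyPrices μ) := by
  have hc := continuous_survival μ
  have hw := continuous_topExcess hμ
  have : riskyPrices μ = ⋂ t : Set.Ici (0 : ℝ),
      {c | 7 / 4 * ((c + t.1) * survival μ (c + t.1)) ≤ c * survival μ c + topExcess μ c} := by
    ext c
    simp [riskyPrices]
  rw [this]
  exact isClosed_iInter fun t => isClosed_le (by fun_prop) (by fun_prop)

theorem mem_riskyPrices_of_le (hμ : μ (Set.Icc 0 B)ᶜ = 0) {c : ℝ} (hc : B ≤ c) :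
    c ∈ riskyPrices μ := by
  intro t ht
  rw [survival_eq_zero hμ hc, survival_eq_zero hμ (by linarith)]
  simpa using topExcess_nonneg hμ c

theorem topRevenue_le_of_mem_riskyPrices (hμ : μ (Set.Icc 0 B)ᶜ = 0) {c : ℝ} (hc : 0 ≤ c)
    (h : c ∈ riskyPrices μ) : 7 / 4 * topRevenue μ c ≤ c * survival μ c + topExcess μ c := by
  have h1 := h (bestPrice μ 0 c - c) (by linarith [le_bestPrice hμ hc])
  rw [add_sub_cancel] at h1
  exact h1

theorem le_topRevenue_of_notMem_riskyPrices (hμ : μ (Set.Icc 0 B)ᶜ = 0) {c : ℝ} (hc : 0 ≤ c)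
    (h : c ∉ riskyPrices μ) : c * survival μ c + topExcess μ c ≤ 7 / 4 * topRevenue μ c := by
  simp only [riskyPrices, Set.mem_ofPred_eq, not_forall, not_le] at h
  obtain ⟨t, ht, h⟩ := h
  have := mul_survival_le_topRevenue hμ hc (le_add_of_nonneg_right ht)
  linarith

theorem zero_notMem_riskyPrices (hμ : μ (Set.Icc 0 B)ᶜ = 0) : (0 : ℝ) ∉ riskyPrices μ := by
  intro h
  have h1 := topRevenue_le_of_mem_riskyPrices hμ le_rfl h
  have h2 := topExcess_le_topRevenue hμ (le_refl 0)
  have h0 : topRevenue μ 0 ≤ 0 := by linarith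
  -- All of the mass would be at `0`.
  have h3 : ∀ t, 0 < t → survival μ t = 0 := by
    intro t ht
    have := mul_survival_le_topRevenue hμ le_rfl ht.le
    exact le_antisymm (nonpos_of_mul_nonpos_right (this.trans h0) ht) (survival_nonneg _ _)
  have h4 : Filter.Tendsto (survival μ) (nhdsWithin 0 (Set.Ioi 0)) (nhds (survival μ 0)) :=
    ((continuous_survival μ).tendsto 0).mono_left nhdsWithin_le_nhds
  have h5 : Filter.Tendsto (survival μ) (nhdsWithin 0 (Set.Ioi 0)) (nhds 0) := by
    refine tendsto_const_nhds.congr' ?_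
    filter_upwards [self_mem_nhdsWithin] with t ht using (h3 t ht).symm
  have := tendsto_nhds_unique h4 h5
  rw [survival_zero hμ] at this
  exact one_ne_zero this

end

/-! ### Revenue of a truthful mechanism from a single bidder -/

/-- The payment identity in a form without integrals: for a single bidder with allocation
probability `x`, let `g` be her payment minus `c` times `x`. Truthfulness makes `g` grow from `s` to
`t` by at most `(t - c) * (x t - x s)`, so that `g` is at most a mixture of the functions that are
`p - c` above a threshold `p ≥ c` and vanish below it; hence the expectation of `g` on `[c, B]` is
at most that of the best such threshold. -/
theorem integral_Ioi_le_of_forall_threshold {μ : Measure ℝ} [IsProbabilityMeasure μ] {B c w : ℝ}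
    (hcB : c ≤ B) (hμ : ∀ᵐ y ∂μ, y ≤ B) (hw : ∀ p, c ≤ p → (p - c) * survival μ p ≤ w)
    {x g : ℝ → ℝ} (hx : MonotoneOn x (Set.Icc c B)) (hx0 : 0 ≤ x c) (hx1 : x B ≤ 1)
    (hg : g c ≤ 0)
    (hstep : ∀ s t, c ≤ s → s ≤ t → t ≤ B → g t ≤ g s + (t - c) * (x t - x s))
    (hint : Integrable g μ) : ∫ y in Set.Ioi c, g y ∂μ ≤ w := by
  have hw0 : 0 ≤ w := by simpa using hw c le_rfl
  have key : ∀ N : ℕ, ∫ y in Set.Ioi c, g y ∂μ ≤ w + (B - c) / (N + 1 : ℕ) := by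
    intro N
    set n := N + 1
    have hn : (0 : ℝ) < (n : ℕ) := by positivity
    set δ := (B - c) / (n : ℕ) with hδ
    have hδ0 : 0 ≤ δ := div_nonneg (by linarith) hn.le
    set s : ℕ → ℝ := fun l => c + l * δ with hs
    have hs_mono : Monotone s := fun a b hab => by
      have : (a : ℝ) ≤ b := by exact_mod_cast hab
      simp only [hs]
      nlinarith
    have hs0 : s 0 = c := by simp [hs]
    have hsn : s n = B := by
      simp only [hs, hδ]
      field_simp
      ring
    have hs_succ : ∀ l, s (l + 1) = s l + δ := fun l => by simp only [hs]; push_cast; ring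
    have hsc : ∀ l, c ≤ s l := fun l => hs0 ▸ hs_mono (Nat.zero_le l)
    have hsB : ∀ l, l ≤ n → s l ≤ B := fun l hl => hsn ▸ hs_mono hl
    have hΔ : ∀ l, l < n → 0 ≤ x (s (l + 1)) - x (s l) := fun l hl =>
      sub_nonneg.mpr (hx ⟨hsc _, hsB _ hl.le⟩ ⟨hsc _, hsB _ hl⟩ (hs_mono l.le_succ))
    set G : ℕ → ℝ → ℝ := fun m y => ∑ l ∈ Finset.range m,
      (s (l + 1) - c) * (x (s (l + 1)) - x (s l)) * (Set.Ici (s l)).indicator 1 y with hG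
    have hterm : ∀ l, l < n → ∀ y : ℝ,
        0 ≤ (s (l + 1) - c) * (x (s (l + 1)) - x (s l)) * (Set.Ici (s l)).indicator 1 y :=
      fun l hl y => mul_nonneg (mul_nonneg (by linarith [hsc (l + 1)]) (hΔ l hl))
        (Set.indicator_nonneg (fun _ _ => zero_le_one) _)
    have hG0 : ∀ m, m ≤ n → ∀ y, 0 ≤ G m y := fun m hm y =>
      Finset.sum_nonneg fun l hl => hterm l (by simp at hl; omega) y
    have hgG : ∀ m, m ≤ n → ∀ y, c ≤ y → y ≤ s m → g y ≤ G m y := by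
      intro m
      induction m with
      | zero =>
        intro _ y hy hy'
        rw [hs0] at hy'
        simpa [hG, le_antisymm hy' hy] using hg
      | succ m ih =>
        intro hm y hy hy'
        have hsucc : ∀ y, G (m + 1) y = G m y + (s (m + 1) - c) * (x (s (m + 1)) - x (s m))
            * (Set.Ici (s m)).indicator 1 y := fun y => by
          simp only [hG, Finset.sum_range_succ]
        rw [hsucc]
        rcases le_total y (s m) with h | h
        · have := ih (by omega) y hy h
          have := hterm m (by omega) y
          linarith
        · have h1 := ih (by omega) (s m) (hsc m) le_rfl
          have h2 := hstep (s m) y (hsc m) h (hy'.trans (hsB _ hm))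
          have h3 : G m (s m) ≤ G m y := by
            refine Finset.sum_le_sum fun l hl => ?_
            have hl' : l < m := by simpa using hl
            refine mul_le_mul_of_nonneg_left ?_
              (mul_nonneg (by linarith [hsc (l + 1)]) (hΔ l (by omega)))
            rw [Set.indicator_of_mem (Set.mem_Ici.mpr ((hs_mono hl'.le).trans h))]
            exact Set.indicator_apply_le' (fun _ => le_rfl) (fun _ => zero_le_one)
          have h4 : x (s m) ≤ x y := hx ⟨hsc _, hsB _ (by omega)⟩
            ⟨hy, hy'.trans (hsB _ hm)⟩ h
          have h5 : x y ≤ x (s (m + 1)) := hx ⟨hy, hy'.trans (hsB _ hm)⟩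
            ⟨hsc _, hsB _ hm⟩ hy'
          rw [Set.indicator_of_mem (Set.mem_Ici.mpr h)]
          simp only [Pi.one_apply, mul_one]
          nlinarith [hsc (m + 1)]
    have hGint : ∀ l, Integrable (fun y => (s (l + 1) - c) * (x (s (l + 1)) - x (s l))
        * (Set.Ici (s l)).indicator 1 y) μ := fun l =>
      ((integrable_const (1 : ℝ)).indicator measurableSet_Ici).const_mul _
    have hGI : Integrable (G n) μ := integrable_finsetSum _ fun l _ => hGint l
    calc ∫ y in Set.Ioi c, g y ∂μ
        ≤ ∫ y in Set.Ioi c, G n y ∂μ := by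
          refine setIntegral_mono_on_ae hint.integrableOn hGI.integrableOn measurableSet_Ioi ?_
          filter_upwards [hμ] with y hy hyc
          exact hgG n le_rfl y (le_of_lt hyc) (hsn ▸ hy)
      _ ≤ ∫ y, G n y ∂μ :=
          setIntegral_le_integral hGI (Filter.Eventually.of_forall fun y => hG0 n le_rfl y)
      _ = ∑ l ∈ Finset.range n,
            (s (l + 1) - c) * (x (s (l + 1)) - x (s l)) * survival μ (s l) := by
          simp only [hG]
          rw [integral_finsetSum _ fun l _ => hGint l]
          refine Finset.sum_congr rfl fun l _ => ?_
          rw [integral_const_mul, integral_indicator_one measurableSet_Ici, survival]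
      _ ≤ ∑ l ∈ Finset.range n, (w + δ) * (x (s (l + 1)) - x (s l)) := by
          refine Finset.sum_le_sum fun l hl => ?_
          have h1 := hw (s l) (hsc l)
          have h2 := survival_le_one μ (s l)
          have h3 : (s (l + 1) - c) * survival μ (s l) ≤ w + δ := by
            rw [hs_succ]
            nlinarith
          have := mul_le_mul_of_nonneg_right h3 (hΔ l (by simpa using hl))
          linarith
      _ = (w + δ) * (x B - x c) := by
          rw [← Finset.mul_sum, Finset.sum_range_sub (fun l => x (s l)), hsn, hs0]
      _ ≤ w + δ := by nlinarith
  have hlim : Filter.Tendsto (fun N : ℕ => w + (B - c) / (N + 1 : ℕ)) Filter.atTop (nhds (w + 0)) :=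
    tendsto_const_nhds.add
      ((tendsto_const_div_atTop_nhds_zero_nat (B - c)).comp (Filter.tendsto_add_atTop_nat 1))
  rw [add_zero] at hlim
  exact ge_of_tendsto' hlim key

/-- Incentive compatibility and individual rationality for a single bidder with values in `[0, B]`:
`x` is the allocation probability and `p` the payment, as functions of the bid. -/
structure IsTruthfulRule (B : ℝ) (x p : ℝ → ℝ) : Prop where
  nonneg : ∀ v ∈ Set.Icc 0 B, 0 ≤ x v
  le_one : ∀ v ∈ Set.Icc 0 B, x v ≤ 1
  ic : ∀ v ∈ Set.Icc 0 B, ∀ b ∈ Set.Icc 0 B, v * x b - p b ≤ v * x v - p v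
  ir : ∀ v ∈ Set.Icc 0 B, 0 ≤ v * x v - p v

theorem IsTruthfulRule.integral_le_topExcess {μ : Measure ℝ} [IsProbabilityMeasure μ]
    [NullSingletonClass μ] {B c : ℝ} {x p : ℝ → ℝ} (h : IsTruthfulRule B x p)
    (hμ : μ (Set.Icc 0 B)ᶜ = 0) (hc : c ∈ Set.Icc 0 B)
    (hint : Integrable (fun y => p y - c * x y) μ) :
    ∫ y in Set.Ioi c, (p y - c * x y) ∂μ ≤ topExcess μ c := by
  have hsub : ∀ y, y ∈ Set.Icc c B → y ∈ Set.Icc 0 B := fun y hy => ⟨hc.1.trans hy.1, hy.2⟩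
  have hB : (0 : ℝ) ≤ B := hc.1.trans hc.2
  have hmono : MonotoneOn x (Set.Icc c B) := by
    intro s hs t ht hst
    rcases hst.eq_or_lt with rfl | hlt
    · exact le_rfl
    have h1 := h.ic s (hsub s hs) t (hsub t ht)
    have h2 := h.ic t (hsub t ht) s (hsub s hs)
    nlinarith
  refine integral_Ioi_le_of_forall_threshold hc.2 ?_
    (fun q hq => sub_mul_survival_le_topExcess hμ hq) hmono (h.nonneg c hc)
    (h.le_one B ⟨hB, le_rfl⟩) (by linarith [h.ir c hc]) ?_ hint
  · filter_upwards [ae_mem_Icc hμ] with y hy using hy.2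
  · intro s t hs hst ht
    linarith [h.ic t ⟨hc.1.trans (hs.trans hst), ht⟩ s ⟨hc.1.trans hs, hst.trans ht⟩]

/-! ### Pooling against continuing, numerically -/

/-- The two options in a risky situation, in units of the cutoff price and conditional on both
bidders being active: `a` and `b` are the excess revenues from the two bidders, `q` and `q'` their
probabilities of reaching the corresponding prices. The risk, which comes from the first bidder,
forces `q ≤ 1 / 4`. If pooling up to the price of the first bidder is not good enough, then `b` is
so large that it pays to let the price rise up to the lower of the two prices. -/
theorem four_sevenths_le_of_risky {a q b q' : ℝ} (ha : 3 / 4 ≤ a) (haq : 7 / 4 * (a + q) ≤ 1 + a)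
    (hq : 0 ≤ q) (hb : 0 ≤ b) (hq' : 0 ≤ q')
    (h : 1 + a / 2 < 4 / 7 * (1 + a + b)) :
    4 / 7 * (1 + a + b) ≤ a + q + b + q' - 1 / 2 * ((a + q) * q' + (b + q') * q) := by
  -- The assumptions on `a` give `a ≥ 3 / 4` and `a + q ≤ 4 / 3`, so that `a / 2 + q < 1`.
  have h1 : 0 ≤ q' * (1 - a / 2 - q) := mul_nonneg hq' (by linarith)
  have h2 : a + b + q * (1 - b / 2) ≤ a + q + b + q' - 1 / 2 * ((a + q) * q' + (b + q') * q) := by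
    nlinarith
  refine le_trans ?_ h2
  rcases le_total b 2 with hb2 | hb2
  · have : 0 ≤ q * (1 - b / 2) := mul_nonneg hq (by linarith)
    linarith
  · nlinarith

theorem four_sevenths_le_of_risky_homogeneous {c Q Q' q q' w w' : ℝ} (hc : 0 < c) (hQ : 0 < Q)
    (hQ' : 0 < Q') (hq : 0 ≤ q) (hq' : 0 ≤ q') (hw' : 0 ≤ w')
    (h1 : 7 / 4 * (c * Q) ≤ c * Q + w) (h2 : 7 / 4 * (w + c * q) ≤ c * Q + w)
    (h : c * Q * Q' + 1 / 2 * (w * Q') < 4 / 7 * (c * Q * Q' + w * Q' + w' * Q)) :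
    4 / 7 * (c * Q * Q' + w * Q' + w' * Q) ≤ (w + c * q) * Q' + (w' + c * q') * Q
      - 1 / 2 * ((w + c * q) * q' + (w' + c * q') * q) := by
  have hcQ : 0 < c * Q := mul_pos hc hQ
  have hcQQ : 0 < c * Q * Q' := mul_pos hcQ hQ'
  have hw : w = w / (c * Q) * (c * Q) := by field_simp
  have hww : w' = w' / (c * Q') * (c * Q') := by field_simp
  have hqq : q = q / Q * Q := by field_simp
  have hqq' : q' = q' / Q' * Q' := by field_simp
  have hb : 0 ≤ w' / (c * Q') := by positivity
  have hq0 : 0 ≤ q / Q := by positivity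
  have hq0' : 0 ≤ q' / Q' := by positivity
  generalize w / (c * Q) = a at hw
  generalize w' / (c * Q') = b at hww hb
  generalize q / Q = r at hqq hq0
  generalize q' / Q' = r' at hqq' hq0'
  subst hw hww hqq hqq'
  have key := four_sevenths_le_of_risky (a := a) (q := r) (b := b) (q' := r')
    (le_of_mul_le_mul_right (by linarith) hcQ)
    (le_of_mul_le_mul_right (by linarith) hcQ) hq0 hb hq0'
    (lt_of_mul_lt_mul_right (by linarith) hcQQ.le)
  have := mul_le_mul_of_nonneg_right key hcQQ.le
  linarith

/-! ### Integrals over regions of the plane -/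

section

variable {μ ν : Measure ℝ} {S : Set ℝ} {U : ℝ → Set ℝ} {F : ℝ → ℝ → ℝ}

theorem integral_indicator_section (hU : ∀ z, MeasurableSet (U z)) (z : ℝ) :
    ∫ y, {q : ℝ × ℝ | q.2 ∈ S ∧ q.1 ∈ U q.2}.indicator (fun q => F q.1 q.2) (y, z) ∂μ
      = S.indicator (fun z => ∫ y in U z, F y z ∂μ) z := by
  by_cases hz : z ∈ S
  · rw [Set.indicator_of_mem hz, ← integral_indicator (hU z)]
    refine integral_congr_ae (Filter.Eventually.of_forall fun y => ?_)
    by_cases hy : y ∈ U z <;> simp [Set.indicator, hz, hy]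
  · rw [Set.indicator_of_notMem hz]
    simp [Set.indicator, hz]

variable [IsProbabilityMeasure μ] [IsProbabilityMeasure ν]

theorem integral_region_eq (hS : MeasurableSet S) (hU : ∀ z, MeasurableSet (U z))
    (hF : Integrable ({q : ℝ × ℝ | q.2 ∈ S ∧ q.1 ∈ U q.2}.indicator fun q => F q.1 q.2)
      (μ.prod ν)) :
    ∫ q, {q : ℝ × ℝ | q.2 ∈ S ∧ q.1 ∈ U q.2}.indicator (fun q => F q.1 q.2) q ∂(μ.prod ν)
      = ∫ z in S, ∫ y in U z, F y z ∂μ ∂ν := by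
  rw [integral_prod_symm _ hF, ← integral_indicator hS]
  exact integral_congr_ae (Filter.Eventually.of_forall fun z => integral_indicator_section hU z)

theorem integrableOn_section (hS : MeasurableSet S) (hU : ∀ z, MeasurableSet (U z))
    (hF : Integrable ({q : ℝ × ℝ | q.2 ∈ S ∧ q.1 ∈ U q.2}.indicator fun q => F q.1 q.2)
      (μ.prod ν)) : IntegrableOn (fun z => ∫ y in U z, F y z ∂μ) S ν := by
  rw [← integrable_indicator_iff hS]
  exact hF.integral_prod_right.congr
    (Filter.Eventually.of_forall fun z => integral_indicator_section hU z)

theorem integral_region_le (hS : MeasurableSet S) (hU : ∀ z, MeasurableSet (U z))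
    (hF : Integrable ({q : ℝ × ℝ | q.2 ∈ S ∧ q.1 ∈ U q.2}.indicator fun q => F q.1 q.2)
      (μ.prod ν)) {h : ℝ → ℝ} (hh : IntegrableOn h S ν)
    (hle : ∀ᵐ z ∂ν, z ∈ S → ∫ y in U z, F y z ∂μ ≤ h z) :
    ∫ q, {q : ℝ × ℝ | q.2 ∈ S ∧ q.1 ∈ U q.2}.indicator (fun q => F q.1 q.2) q ∂(μ.prod ν)
      ≤ ∫ z in S, h z ∂ν := by
  rw [integral_region_eq hS hU hF]
  exact setIntegral_mono_on_ae (integrableOn_section hS hU hF) hh hS hle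

theorem le_integral_region (hS : MeasurableSet S) (hU : ∀ z, MeasurableSet (U z))
    (hF : Integrable ({q : ℝ × ℝ | q.2 ∈ S ∧ q.1 ∈ U q.2}.indicator fun q => F q.1 q.2)
      (μ.prod ν)) {h : ℝ → ℝ} (hh : IntegrableOn h S ν)
    (hle : ∀ᵐ z ∂ν, z ∈ S → h z ≤ ∫ y in U z, F y z ∂μ) :
    ∫ z in S, h z ∂ν ≤
      ∫ q, {q : ℝ × ℝ | q.2 ∈ S ∧ q.1 ∈ U q.2}.indicator (fun q => F q.1 q.2) q ∂(μ.prod ν) := by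
  rw [integral_region_eq hS hU hF]
  exact setIntegral_mono_on_ae hh (integrableOn_section hS hU hF) hS hle

end

/-! ### The auction with two active bidders -/

/-- The price for the last active bidder when the cutoff price is `c`. Truncating `c` at `0` makes
the price monotone, hence measurable, on the whole line. -/
noncomputable def lastPrice (μ : Measure ℝ) (c : ℝ) : ℝ := bestPrice μ 0 (max c 0)

/-- The seller's revenue when two bidders are active, the values in `[a, b)` are pooled, and the
price rises continuously otherwise: `y` is the higher value, `z` the lower one, and `p` the
price function of the bidder with value `y`. -/
noncomputable def pairRevenue (p : ℝ → ℝ) (a b y z : ℝ) : ℝ :=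
  if a ≤ z ∧ z < b then
    (if y < b then a else 1 / 2 * a + (if p b ≤ y then 1 / 2 * p b else 0))
  else if p z ≤ y then p z else 0

section

variable {μ ν : Measure ℝ} [IsProbabilityMeasure μ] [NullSingletonClass μ]
  [IsProbabilityMeasure ν] [NullSingletonClass ν] {B : ℝ}

theorem measurable_lastPrice (hμ : μ (Set.Icc 0 B)ᶜ = 0) : Measurable (lastPrice μ) := by
  refine Monotone.measurable fun c c' h => ?_
  exact bestPrice_mono hμ (le_max_right _ _) (le_max_right _ _) le_rfl (max_le_max h le_rfl)

theorem lastPrice_of_nonneg {c : ℝ} (hc : 0 ≤ c) : lastPrice μ c = bestPrice μ 0 c := by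
  rw [lastPrice, max_eq_left hc]

theorem integrableOn_topRevenue (hμ : μ (Set.Icc 0 B)ᶜ = 0) {S : Set ℝ} (hS : MeasurableSet S)
    (hS0 : ∀ z ∈ S, 0 ≤ z) : IntegrableOn (topRevenue μ) S ν := by
  have hanti := topRevenue_antitoneOn hμ
  refine Integrable.of_bound (C := topRevenue μ 0) ?_ ?_
  · exact (aemeasurable_restrict_of_antitoneOn hS
      (hanti.mono fun z hz => hS0 z hz)).aestronglyMeasurable
  · refine (ae_restrict_iff' hS).mpr (Filter.Eventually.of_forall fun z hz => ?_)
    rw [Real.norm_of_nonneg (topRevenue_nonneg hμ (hS0 z hz))]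
    exact hanti (Set.mem_Ici.mpr le_rfl) (hS0 z hz) (hS0 z hz)

theorem setIntegral_Ioi_indicator_Ici {z p : ℝ} (hp : z ≤ p) (k : ℝ) :
    ∫ y in Set.Ioi z, (Set.Ici p).indicator (fun _ => k) y ∂μ = k * survival μ p := by
  rw [setIntegral_congr_set Ioi_ae_eq_Ici, setIntegral_indicator measurableSet_Ici,
    Set.inter_eq_right.mpr (Set.Ici_subset_Ici.mpr hp), setIntegral_const, survival, smul_eq_mul,
    mul_comm]

theorem setIntegral_pairRevenue_of_not_pooled (hμ : μ (Set.Icc 0 B)ᶜ = 0) {a b z : ℝ} (hz : 0 ≤ z)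
    (h : ¬ (a ≤ z ∧ z < b)) :
    ∫ y in Set.Ioi z, pairRevenue (lastPrice μ) a b y z ∂μ = topRevenue μ z := by
  have : (fun y => pairRevenue (lastPrice μ) a b y z)
      = (Set.Ici (bestPrice μ 0 z)).indicator fun _ => bestPrice μ 0 z := by
    funext y
    simp [pairRevenue, h, Set.indicator_apply, lastPrice_of_nonneg hz]
  rw [this, setIntegral_Ioi_indicator_Ici (le_bestPrice hμ hz), topRevenue]

theorem setIntegral_pairRevenue_of_pooled (hμ : μ (Set.Icc 0 B)ᶜ = 0) {a b z : ℝ} (hz : 0 ≤ z)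
    (h : a ≤ z ∧ z < b) :
    ∫ y in Set.Ioi z, pairRevenue (lastPrice μ) a b y z ∂μ
      = a * survival μ z + 1 / 2 * (topRevenue μ b - a * survival μ b) := by
  have hb0 : 0 ≤ b := hz.trans h.2.le
  have hpb := le_bestPrice hμ hb0
  set p := bestPrice μ 0 b with hp
  have heq : (fun y => pairRevenue (lastPrice μ) a b y z)
      = fun y => a + (Set.Ici b).indicator (fun _ => -(1 / 2 * a)) y
        + (Set.Ici p).indicator (fun _ => 1 / 2 * p) y := by
    funext y
    simp only [pairRevenue, lastPrice_of_nonneg hb0, h, and_self, if_true,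
      Set.indicator_apply, Set.mem_Ici, ← hp]
    rcases lt_or_ge y b with hy | hy
    · have : ¬ p ≤ y := not_le.mpr (hy.trans_le hpb)
      simp [hy, this]
    · simp only [hy, not_lt.mpr hy, if_true, if_false]
      ring
  have hi1 : Integrable (fun _ : ℝ => a) (μ.restrict (Set.Ioi z)) := integrable_const _
  have hi2 : Integrable ((Set.Ici b).indicator fun _ => -(1 / 2 * a)) (μ.restrict (Set.Ioi z)) :=
    (integrable_const _).indicator measurableSet_Ici
  have hi3 : Integrable ((Set.Ici p).indicator fun _ => 1 / 2 * p) (μ.restrict (Set.Ioi z)) :=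
    (integrable_const _).indicator measurableSet_Ici
  have hsum : ∫ y in Set.Ioi z, (a + (Set.Ici b).indicator (fun _ => -(1 / 2 * a)) y
      + (Set.Ici p).indicator (fun _ => 1 / 2 * p) y) ∂μ
      = (∫ _ in Set.Ioi z, a ∂μ)
        + (∫ y in Set.Ioi z, (Set.Ici b).indicator (fun _ => -(1 / 2 * a)) y ∂μ)
        + ∫ y in Set.Ioi z, (Set.Ici p).indicator (fun _ => 1 / 2 * p) y ∂μ := by
    rw [← integral_add hi1 hi2]
    exact integral_add (hi1.add hi2) hi3
  rw [heq, hsum,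
    setIntegral_Ioi_indicator_Ici h.2.le, setIntegral_Ioi_indicator_Ici (h.2.le.trans hpb),
    setIntegral_const, measureReal_Ioi_eq_survival, topRevenue, smul_eq_mul, ← hp]
  ring

theorem le_setIntegral_pairRevenue (hμ : μ (Set.Icc 0 B)ᶜ = 0) {a b z : ℝ} (ha : 0 ≤ a)
    (hab : a ≤ b) (hz : a ≤ z) :
    a * survival μ z + 1 / 2 * (b - a) * survival μ (max z b)
      ≤ ∫ y in Set.Ioi z, pairRevenue (lastPrice μ) a b y z ∂μ := by
  have hz0 : 0 ≤ z := ha.trans hz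
  rcases lt_or_ge z b with h | h
  · rw [setIntegral_pairRevenue_of_pooled hμ hz0 ⟨hz, h⟩, max_eq_right h.le]
    have := mul_survival_le_topRevenue hμ (ha.trans hab) (le_refl b)
    linarith
  · rw [setIntegral_pairRevenue_of_not_pooled hμ hz0 fun h' => not_lt.mpr h h'.2, max_eq_left h]
    have := mul_survival_le_topRevenue hμ hz0 (le_refl z)
    nlinarith [survival_nonneg μ z]

theorem measurable_pairRevenue {p : ℝ → ℝ} (hp : Measurable p) :
    Measurable fun t : ℝ × ℝ × ℝ × ℝ => pairRevenue p t.1 t.2.1 t.2.2.1 t.2.2.2 := by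
  unfold pairRevenue
  have h1 : Measurable fun t : ℝ × ℝ × ℝ × ℝ => t.1 := by fun_prop
  have h2 : Measurable fun t : ℝ × ℝ × ℝ × ℝ => t.2.1 := by fun_prop
  have h3 : Measurable fun t : ℝ × ℝ × ℝ × ℝ => t.2.2.1 := by fun_prop
  have h4 : Measurable fun t : ℝ × ℝ × ℝ × ℝ => t.2.2.2 := by fun_prop
  refine Measurable.ite ((measurableSet_le h1 h4).inter (measurableSet_lt h4 h2))
    (Measurable.ite (measurableSet_lt h3 h2) h1 (Measurable.add (h1.const_mul _)
      (Measurable.ite (measurableSet_le (hp.comp h2) h3) ((hp.comp h2).const_mul _)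
        measurable_const)))
    (Measurable.ite (measurableSet_le (hp.comp h4) h3) (hp.comp h4) measurable_const)

end

section

variable {μ ν : Measure ℝ} [IsProbabilityMeasure μ] [NullSingletonClass μ]
  [IsProbabilityMeasure ν] [NullSingletonClass ν] {B : ℝ}

theorem ae_prod_mem_Icc (hμ : μ (Set.Icc 0 B)ᶜ = 0) (hν : ν (Set.Icc 0 B)ᶜ = 0) :
    ∀ᵐ q ∂(μ.prod ν), q.1 ∈ Set.Icc 0 B ∧ q.2 ∈ Set.Icc 0 B :=
  (Measure.quasiMeasurePreserving_fst.ae (ae_mem_Icc hμ)).and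
    (Measure.quasiMeasurePreserving_snd.ae (ae_mem_Icc hν))

theorem integrable_prod_of_bound (hμ : μ (Set.Icc 0 B)ᶜ = 0) (hν : ν (Set.Icc 0 B)ᶜ = 0)
    {f : ℝ × ℝ → ℝ} (hf : Measurable f) {C : ℝ}
    (hC : ∀ y ∈ Set.Icc 0 B, ∀ z ∈ Set.Icc 0 B, |f (y, z)| ≤ C) :
    Integrable f (μ.prod ν) := by
  refine Integrable.of_bound (C := C) hf.aestronglyMeasurable ?_
  filter_upwards [ae_prod_mem_Icc hμ hν] with q hq
  exact hC q.1 hq.1 q.2 hq.2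

theorem lastPrice_ge (hμ : μ (Set.Icc 0 B)ᶜ = 0) (c : ℝ) : max c 0 ≤ lastPrice μ c :=
  le_bestPrice hμ (le_max_right _ _)

theorem pairRevenue_mem_Icc (hμ : μ (Set.Icc 0 B)ᶜ = 0) {a b y z : ℝ} (ha : 0 ≤ a)
    (hz : z ∈ Set.Icc 0 B) (hy : y ∈ Set.Icc 0 B) :
    pairRevenue (lastPrice μ) a b y z ∈ Set.Icc 0 B := by
  have hb0 : 0 ≤ lastPrice μ b := (le_max_right _ _).trans (lastPrice_ge hμ b)
  have hz0 : 0 ≤ lastPrice μ z := (le_max_right _ _).trans (lastPrice_ge hμ z)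
  have hB : 0 ≤ B := hz.1.trans hz.2
  unfold pairRevenue
  split_ifs with h1 h2 h3 h4
  · exact ⟨ha, h1.1.trans hz.2⟩
  · exact ⟨by linarith, by linarith [h1.1, hz.2, hy.2]⟩
  · exact ⟨by linarith, by linarith [h1.1, hz.2]⟩
  · exact ⟨hz0, h4.trans hy.2⟩
  · exact ⟨le_rfl, hB⟩

theorem measurableSet_region_Ioi (c : ℝ) :
    MeasurableSet {q : ℝ × ℝ | q.2 ∈ Set.Ioi c ∧ q.1 ∈ Set.Ioi q.2} :=
  (measurableSet_lt measurable_const measurable_snd).inter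
    (measurableSet_lt measurable_snd measurable_fst)

theorem measurable_pairRevenue_const (hμ : μ (Set.Icc 0 B)ᶜ = 0) (a b : ℝ) :
    Measurable fun q : ℝ × ℝ => pairRevenue (lastPrice μ) a b q.1 q.2 :=
  (measurable_pairRevenue (measurable_lastPrice hμ)).comp
    (measurable_const.prodMk (measurable_const.prodMk measurable_id))

theorem integrable_region_pairRevenue (hμ : μ (Set.Icc 0 B)ᶜ = 0) (hν : ν (Set.Icc 0 B)ᶜ = 0)
    {a : ℝ} (ha : 0 ≤ a) (b c : ℝ) :
    Integrable ({q : ℝ × ℝ | q.2 ∈ Set.Ioi c ∧ q.1 ∈ Set.Ioi q.2}.indicator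
      fun q => pairRevenue (lastPrice μ) a b q.1 q.2) (μ.prod ν) :=
  (integrable_prod_of_bound hμ hν (measurable_pairRevenue_const hμ a b) fun y hy z hz => by
    have := pairRevenue_mem_Icc (b := b) hμ ha hz hy
    rw [abs_of_nonneg this.1]
    exact this.2).indicator (measurableSet_region_Ioi c)

/-- A lower bound on the revenue from the bidder with law `μ` when she has the higher value and the
price `c` is reached. In the pooled interval `[a, b)` and above it, this is at least what a
seller would get who charges `a`, and half of `b - a` more whenever the higher value is at least
`b`. -/
theorem le_integral_pairRevenue (hμ : μ (Set.Icc 0 B)ᶜ = 0) (hν : ν (Set.Icc 0 B)ᶜ = 0)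
    {a b c : ℝ} (hc : 0 ≤ c) (hca : c ≤ a) (hab : a ≤ b) :
    (∫ z in Set.Ioc c a, topRevenue μ z ∂ν)
        + ∫ z in Set.Ioi a, (a * survival μ z + 1 / 2 * (b - a) * survival μ (max z b)) ∂ν
      ≤ ∫ q, {q : ℝ × ℝ | q.2 ∈ Set.Ioi c ∧ q.1 ∈ Set.Ioi q.2}.indicator
        (fun q => pairRevenue (lastPrice μ) a b q.1 q.2) q ∂(μ.prod ν) := by
  have ha : 0 ≤ a := hc.trans hca
  set g : ℝ → ℝ := fun z => a * survival μ z + 1 / 2 * (b - a) * survival μ (max z b) with hg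
  have hgc : Continuous g := by
    have := continuous_survival μ
    fun_prop
  set h : ℝ → ℝ := fun z => if z ≤ a then topRevenue μ z else g z with hh
  have h1 : Set.EqOn h (topRevenue μ) (Set.Ioc c a) := fun z hz => if_pos hz.2
  have h2 : Set.EqOn h g (Set.Ioi a) := fun z hz => if_neg (not_le.mpr hz)
  have i1 : IntegrableOn h (Set.Ioc c a) ν :=
    (integrableOn_topRevenue hμ measurableSet_Ioc fun z hz => hc.trans hz.1.le).congr_fun
      h1.symm measurableSet_Ioc
  have i2 : IntegrableOn g (Set.Ioi a) ν := by
    refine Integrable.integrableOn (Integrable.of_bound (C := a + 1 / 2 * (b - a))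
      hgc.aestronglyMeasurable (Filter.Eventually.of_forall fun z => ?_))
    have s1 := survival_nonneg μ z
    have s2 := survival_nonneg μ (max z b)
    have s3 := survival_le_one μ z
    have s4 := survival_le_one μ (max z b)
    rw [Real.norm_of_nonneg (by simp only [hg]; have := sub_nonneg.mpr hab; positivity)]
    simp only [hg]
    nlinarith
  have i2' : IntegrableOn h (Set.Ioi a) ν := i2.congr_fun h2.symm measurableSet_Ioi
  have hdisj : Disjoint (Set.Ioc c a) (Set.Ioi a) :=
    Set.disjoint_left.mpr fun z hz hz' => not_lt.mpr hz.2 hz'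
  rw [← setIntegral_congr_fun measurableSet_Ioc h1, ← setIntegral_congr_fun measurableSet_Ioi h2,
    ← setIntegral_union hdisj measurableSet_Ioi i1 i2', Set.Ioc_union_Ioi_eq_Ioi hca]
  refine le_integral_region (F := fun y z => pairRevenue (lastPrice μ) a b y z)
    (U := Set.Ioi) measurableSet_Ioi (fun z => measurableSet_Ioi)
    (integrable_region_pairRevenue hμ hν ha b c) ?_ ?_
  · rw [← Set.Ioc_union_Ioi_eq_Ioi hca]
    exact i1.union i2'
  · have hne : ∀ᵐ z ∂ν, z ≠ a := by simp [ae_iff]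
    filter_upwards [hne] with z hza hz
    have hz0 : 0 ≤ z := hc.trans (le_of_lt hz)
    simp only [hh]
    split_ifs with hle
    · refine (setIntegral_pairRevenue_of_not_pooled hμ hz0 fun h' => ?_).ge
      exact hza (le_antisymm hle h'.1)
    · exact le_setIntegral_pairRevenue hμ ha hab (not_le.mp hle).le

theorem measureReal_region_eq {S : Set ℝ} {U : ℝ → Set ℝ} (hS : MeasurableSet S)
    (hU : ∀ z, MeasurableSet (U z)) (hSU : MeasurableSet {q : ℝ × ℝ | q.2 ∈ S ∧ q.1 ∈ U q.2}) :
    (μ.prod ν).real {q : ℝ × ℝ | q.2 ∈ S ∧ q.1 ∈ U q.2} = ∫ z in S, μ.real (U z) ∂ν := by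
  have h := integral_region_eq (μ := μ) (ν := ν) (F := fun _ _ => 1) hS hU
    ((integrable_const 1).indicator hSU)
  rw [integral_indicator_const _ hSU] at h
  simpa using h

/-- If the value of the first bidder is at least `b` and that of the second at least `a ≤ b`, then
one of the two is the higher value, and that one is at least `b`. -/
theorem survival_mul_survival_le {a b : ℝ} (hab : a ≤ b) :
    survival μ b * survival ν a
      ≤ (∫ z in Set.Ioi a, survival μ (max z b) ∂ν)
        + ∫ y in Set.Ioi a, survival ν (max y b) ∂μ := by
  have hm : MeasurableSet {q : ℝ × ℝ | q.2 ∈ Set.Ioi a ∧ q.1 ∈ Set.Ici (max q.2 b)} :=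
    (measurableSet_lt measurable_const measurable_snd).inter
      (measurableSet_le (measurable_snd.max measurable_const) measurable_fst)
  have h1 := measureReal_region_eq (μ := μ) (ν := ν) (U := fun z => Set.Ici (max z b))
    measurableSet_Ioi (fun _ => measurableSet_Ici) hm
  have h2 := measureReal_region_eq (μ := ν) (ν := μ) (U := fun z => Set.Ici (max z b))
    measurableSet_Ioi (fun _ => measurableSet_Ici) hm
  have h3 : (ν.prod μ).real {q : ℝ × ℝ | q.2 ∈ Set.Ioi a ∧ q.1 ∈ Set.Ici (max q.2 b)}
      = (μ.prod ν).real {q : ℝ × ℝ | q.1 ∈ Set.Ioi a ∧ q.2 ∈ Set.Ici (max q.1 b)} := by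
    rw [← Measure.prod_swap, measureReal_def, Measure.map_apply measurable_swap hm,
      ← measureReal_def]
    rfl
  simp only [survival]
  rw [← h1, ← h2, h3, ← survival, ← survival, ← measureReal_Ioi_eq_survival,
    ← measureReal_Ioi_eq_survival, ← measureReal_prod_prod]
  refine (measureReal_mono ?_).trans (measureReal_union_le _ _)
  rintro ⟨y, z⟩ ⟨hy, hz⟩
  simp only [Set.mem_Ioi] at hy hz
  rcases le_total z y with h | h
  · exact Or.inl ⟨hz, max_le h (le_of_lt hy)⟩
  · exact Or.inr ⟨lt_of_le_of_lt hab hy, max_le h ((le_of_lt hy).trans h)⟩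

/-- A lower bound, in terms of the values `c` and `a ≤ b`, on the revenue of the auction that starts
at the cutoff price `c` with two active bidders and pools the values in `[a, b)`. -/
noncomputable def poolingBound (μ ν : Measure ℝ) (c a b : ℝ) : ℝ :=
  (∫ z in Set.Ioc c a, topRevenue μ z ∂ν) + (∫ y in Set.Ioc c a, topRevenue ν y ∂μ)
    + a * (survival μ a * survival ν a)
    + 1 / 2 * (b - a) * max (survival μ b * survival ν a) (survival ν b * survival μ a)

theorem poolingBound_comm (μ ν : Measure ℝ) (c a b : ℝ) :
    poolingBound μ ν c a b = poolingBound ν μ c a b := by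
  rw [poolingBound, poolingBound, max_comm, mul_comm (survival μ a)]
  ring

theorem integrable_survival_comp {f : ℝ → ℝ} (hf : Continuous f) :
    Integrable (fun z => survival μ (f z)) ν :=
  Integrable.of_bound (C := 1) ((continuous_survival μ).comp hf).aestronglyMeasurable
    (Filter.Eventually.of_forall fun z => by
      rw [Real.norm_of_nonneg (survival_nonneg _ _)]
      exact survival_le_one _ _)

theorem poolingBound_le (hμ : μ (Set.Icc 0 B)ᶜ = 0) (hν : ν (Set.Icc 0 B)ᶜ = 0)
    {a b c : ℝ} (hc : 0 ≤ c) (hca : c ≤ a) (hab : a ≤ b) :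
    poolingBound μ ν c a b ≤
      (∫ q, {q : ℝ × ℝ | q.2 ∈ Set.Ioi c ∧ q.1 ∈ Set.Ioi q.2}.indicator
        (fun q => pairRevenue (lastPrice μ) a b q.1 q.2) q ∂(μ.prod ν))
      + ∫ q, {q : ℝ × ℝ | q.2 ∈ Set.Ioi c ∧ q.1 ∈ Set.Ioi q.2}.indicator
        (fun q => pairRevenue (lastPrice ν) a b q.1 q.2) q ∂(ν.prod μ) := by
  have e1 := le_integral_pairRevenue hμ hν hc hca hab
  have e2 := le_integral_pairRevenue hν hμ hc hca hab
  have split : ∀ (α β : Measure ℝ) [IsProbabilityMeasure α] [NullSingletonClass α]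
      [IsProbabilityMeasure β] [NullSingletonClass β],
      ∫ z in Set.Ioi a, (a * survival α z + 1 / 2 * (b - a) * survival α (max z b)) ∂β
        = a * (∫ z in Set.Ioi a, survival α (max z a) ∂β)
          + 1 / 2 * (b - a) * ∫ z in Set.Ioi a, survival α (max z b) ∂β := by
    intro α β _ _ _ _
    have hz : ∫ z in Set.Ioi a, survival α (max z a) ∂β = ∫ z in Set.Ioi a, survival α z ∂β :=
      setIntegral_congr_fun measurableSet_Ioi fun z hz => by
        simp only [max_eq_left (Set.mem_Ioi.mp hz).le]
    rw [hz, ← integral_const_mul, ← integral_const_mul]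
    exact integral_add ((integrable_survival_comp continuous_id).integrableOn.const_mul a)
      ((integrable_survival_comp (continuous_id.max continuous_const)).integrableOn.const_mul _)
  rw [split] at e1 e2
  have f1 := survival_mul_survival_le (μ := μ) (ν := ν) (le_refl a)
  have f2 := survival_mul_survival_le (μ := μ) (ν := ν) hab
  have f3 := survival_mul_survival_le (μ := ν) (ν := μ) hab
  have f4 := max_le f2 (f3.trans_eq (add_comm _ _))
  have g1 := mul_le_mul_of_nonneg_left f1 (hc.trans hca)
  have g2 := mul_le_mul_of_nonneg_left f4 (mul_nonneg one_half_pos.le (sub_nonneg.mpr hab))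
  unfold poolingBound
  linarith

end

/-! ### Upper bound on the revenue of truthful mechanisms with two relevant bidders -/

section

variable {μ ν : Measure ℝ} [IsProbabilityMeasure μ] [NullSingletonClass μ]
  [IsProbabilityMeasure ν] [NullSingletonClass ν] {B : ℝ}

theorem IsTruthfulRule.pay_le {x p : ℝ → ℝ} (h : IsTruthfulRule B x p) {v : ℝ}
    (hv : v ∈ Set.Icc 0 B) : p v ≤ v * x v := by linarith [h.ir v hv]

theorem IsTruthfulRule.abs_pay_sub_le {x p : ℝ → ℝ} (h : IsTruthfulRule B x p)
    (hp : ∀ v ∈ Set.Icc 0 B, 0 ≤ p v) {v c : ℝ} (hv : v ∈ Set.Icc 0 B) (hc : c ∈ Set.Icc 0 B) :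
    |p v - c * x v| ≤ B := by
  have h1 := h.pay_le hv
  have h2 := hp v hv
  have h3 := h.nonneg v hv
  have h4 := h.le_one v hv
  rw [abs_le]
  constructor <;> nlinarith [hv.1, hv.2, hc.1, hc.2]

variable {X P : ℝ → ℝ → ℝ}

theorem integrable_pay_sub (hμ : μ (Set.Icc 0 B)ᶜ = 0)
    (hXm : Measurable fun q : ℝ × ℝ => X q.1 q.2) (hPm : Measurable fun q : ℝ × ℝ => P q.1 q.2)
    (hX : ∀ z ∈ Set.Icc 0 B, IsTruthfulRule B (fun y => X y z) fun y => P y z)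
    (hP : ∀ y ∈ Set.Icc 0 B, ∀ z ∈ Set.Icc 0 B, 0 ≤ P y z) {c z : ℝ} (hc : c ∈ Set.Icc 0 B)
    (hz : z ∈ Set.Icc 0 B) : Integrable (fun y => P y z - c * X y z) μ := by
  have h1 : Measurable fun y => X y z := hXm.comp (measurable_id.prodMk measurable_const)
  have h2 : Measurable fun y => P y z := hPm.comp (measurable_id.prodMk measurable_const)
  refine Integrable.of_bound (C := B) (h2.sub (h1.const_mul c)).aestronglyMeasurable ?_
  filter_upwards [ae_mem_Icc hμ] with y hy
  exact (hX z hz).abs_pay_sub_le (fun v hv => hP v hv z hz) hy hc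

/-- When the lower value `z` is not risky for the bidder with law `μ`, who has the higher value,
the revenue from her together with `z` from all others is covered by her optimal revenue. -/
theorem integral_pay_add_le (hμ : μ (Set.Icc 0 B)ᶜ = 0) (hν : ν (Set.Icc 0 B)ᶜ = 0) {c₀ c₁ : ℝ}
    (h0 : 0 ≤ c₀) (hs : ∀ z ∈ Set.Ico c₀ c₁, z ∉ riskyPrices μ)
    (hXm : Measurable fun q : ℝ × ℝ => X q.1 q.2) (hPm : Measurable fun q : ℝ × ℝ => P q.1 q.2)
    (hX : ∀ z ∈ Set.Icc 0 B, IsTruthfulRule B (fun y => X y z) fun y => P y z)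
    (hP : ∀ y ∈ Set.Icc 0 B, ∀ z ∈ Set.Icc 0 B, 0 ≤ P y z) :
    Integrable ({q : ℝ × ℝ | q.2 ∈ Set.Ioc c₀ c₁ ∧ q.1 ∈ Set.Ioi q.2}.indicator
        fun q => P q.1 q.2 - q.2 * X q.1 q.2 + q.2) (μ.prod ν) ∧
      ∫ q, {q : ℝ × ℝ | q.2 ∈ Set.Ioc c₀ c₁ ∧ q.1 ∈ Set.Ioi q.2}.indicator
          (fun q => P q.1 q.2 - q.2 * X q.1 q.2 + q.2) q ∂(μ.prod ν)
        ≤ 7 / 4 * ∫ z in Set.Ioc c₀ c₁, topRevenue μ z ∂ν := by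
  have hm : MeasurableSet {q : ℝ × ℝ | q.2 ∈ Set.Ioc c₀ c₁ ∧ q.1 ∈ Set.Ioi q.2} :=
    (measurable_snd measurableSet_Ioc).inter (measurableSet_lt measurable_snd measurable_fst)
  have hI : Integrable ({q : ℝ × ℝ | q.2 ∈ Set.Ioc c₀ c₁ ∧ q.1 ∈ Set.Ioi q.2}.indicator
      fun q => P q.1 q.2 - q.2 * X q.1 q.2 + q.2) (μ.prod ν) := by
    refine (integrable_prod_of_bound (C := B + B) hμ hν ?_ fun y hy z hz => ?_).indicator hm
    · exact (hPm.sub (measurable_snd.mul hXm)).add measurable_snd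
    · refine (abs_add_le _ _).trans (add_le_add ?_ ?_)
      · exact (hX z hz).abs_pay_sub_le (fun v hv => hP v hv z hz) hy hz
      · exact (abs_of_nonneg hz.1).trans_le hz.2
  refine ⟨hI, ?_⟩
  rw [← integral_const_mul]
  refine integral_region_le (F := fun y z => P y z - z * X y z + z) (U := Set.Ioi)
    measurableSet_Ioc (fun z => measurableSet_Ioi) hI
    ((integrableOn_topRevenue hμ measurableSet_Ioc fun z hz => h0.trans hz.1.le).const_mul _) ?_
  have hne : ∀ᵐ z ∂ν, z ≠ c₁ := by simp [ae_iff]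
  filter_upwards [hne, ae_mem_Icc hν] with z hz1 hzB hz
  have hi := integrable_pay_sub hμ hXm hPm hX hP hzB hzB
  rw [integral_add hi.integrableOn (integrable_const z), setIntegral_const,
    measureReal_Ioi_eq_survival, smul_eq_mul]
  have e1 := (hX z hzB).integral_le_topExcess hμ hzB hi
  have e2 := le_topRevenue_of_notMem_riskyPrices hμ hzB.1
    (hs z ⟨hz.1.le, lt_of_le_of_ne hz.2 hz1⟩)
  linarith

theorem integral_excess_pay_le (hμ : μ (Set.Icc 0 B)ᶜ = 0) (hν : ν (Set.Icc 0 B)ᶜ = 0) {c : ℝ}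
    (hc : c ∈ Set.Icc 0 B)
    (hXm : Measurable fun q : ℝ × ℝ => X q.1 q.2) (hPm : Measurable fun q : ℝ × ℝ => P q.1 q.2)
    (hX : ∀ z ∈ Set.Icc 0 B, IsTruthfulRule B (fun y => X y z) fun y => P y z)
    (hP : ∀ y ∈ Set.Icc 0 B, ∀ z ∈ Set.Icc 0 B, 0 ≤ P y z) :
    Integrable ({q : ℝ × ℝ | q.2 ∈ Set.Ioi c ∧ q.1 ∈ Set.Ioi c}.indicator
        fun q => P q.1 q.2 - c * X q.1 q.2) (μ.prod ν) ∧
      ∫ q, {q : ℝ × ℝ | q.2 ∈ Set.Ioi c ∧ q.1 ∈ Set.Ioi c}.indicator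
          (fun q => P q.1 q.2 - c * X q.1 q.2) q ∂(μ.prod ν)
        ≤ topExcess μ c * survival ν c := by
  have hm : MeasurableSet {q : ℝ × ℝ | q.2 ∈ Set.Ioi c ∧ q.1 ∈ Set.Ioi c} :=
    (measurable_snd measurableSet_Ioi).inter (measurable_fst measurableSet_Ioi)
  have hI : Integrable ({q : ℝ × ℝ | q.2 ∈ Set.Ioi c ∧ q.1 ∈ Set.Ioi c}.indicator
      fun q => P q.1 q.2 - c * X q.1 q.2) (μ.prod ν) :=
    (integrable_prod_of_bound (C := B) hμ hν (hPm.sub (hXm.const_mul c)) fun y hy z hz =>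
      (hX z hz).abs_pay_sub_le (fun v hv => hP v hv z hz) hy hc).indicator hm
  refine ⟨hI, ?_⟩
  have hconst : topExcess μ c * survival ν c = ∫ _ in Set.Ioi c, topExcess μ c ∂ν := by
    rw [setIntegral_const, measureReal_Ioi_eq_survival, smul_eq_mul, mul_comm]
  rw [hconst]
  refine integral_region_le (F := fun y z => P y z - c * X y z) (U := fun _ => Set.Ioi c)
    measurableSet_Ioi (fun z => measurableSet_Ioi) hI (integrable_const _) ?_
  filter_upwards [ae_mem_Icc hν] with z hzB _
  exact (hX z hzB).integral_le_topExcess hμ hc (integrable_pay_sub hμ hXm hPm hX hP hc hzB)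

theorem ae_prod_ne : ∀ᵐ q ∂(μ.prod ν), q.1 ≠ q.2 := by
  have hm : MeasurableSet {q : ℝ × ℝ | q.1 = q.2} :=
    measurableSet_eq_fun measurable_fst measurable_snd
  have : (μ.prod ν) {q : ℝ × ℝ | q.1 = q.2} = 0 := by
    rw [Measure.measure_prod_null hm]
    refine Filter.Eventually.of_forall fun y => ?_
    have : Prod.mk y ⁻¹' {q : ℝ × ℝ | q.1 = q.2} = {y} := by
      ext z
      simp [eq_comm]
    change ν (Prod.mk y ⁻¹' {q : ℝ × ℝ | q.1 = q.2}) = 0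
    rw [this]
    exact measure_singleton y
  rw [ae_iff]
  simpa using this

/-- An upper bound on the optimal revenue, conditional on two bidders being active at the cutoff
price `c` and multiplied by the probability of this event: besides what these two pay above `c`,
nobody contributes more than `c`. -/
noncomputable def excessBound (μ ν : Measure ℝ) (c : ℝ) : ℝ :=
  c * survival μ c * survival ν c + topExcess μ c * survival ν c + topExcess ν c * survival μ c

theorem excessBound_comm (μ ν : Measure ℝ) (c : ℝ) : excessBound μ ν c = excessBound ν μ c := by
  unfold excessBound
  ring

/-- The total payment `T` in a mechanism with allocation probabilities `X`, `Y` and payments `P`,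
`R` of two bidders, while all others have values of at most `c₀`. The price `c₁` is such that no
bidder is risky before `c₁`. -/
theorem integral_totalPayment_le (hμ : μ (Set.Icc 0 B)ᶜ = 0) (hν : ν (Set.Icc 0 B)ᶜ = 0)
    {c₀ c₁ : ℝ} (h0 : 0 ≤ c₀) (h01 : c₀ ≤ c₁) (h1B : c₁ ≤ B)
    (hsμ : ∀ z ∈ Set.Ico c₀ c₁, z ∉ riskyPrices μ) (hsν : ∀ z ∈ Set.Ico c₀ c₁, z ∉ riskyPrices ν)
    {X Y P R T : ℝ → ℝ → ℝ}
    (hXm : Measurable fun q : ℝ × ℝ => X q.1 q.2) (hYm : Measurable fun q : ℝ × ℝ => Y q.1 q.2)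
    (hPm : Measurable fun q : ℝ × ℝ => P q.1 q.2) (hRm : Measurable fun q : ℝ × ℝ => R q.1 q.2)
    (hX : ∀ z ∈ Set.Icc 0 B, IsTruthfulRule B (fun y => X y z) fun y => P y z)
    (hY : ∀ y ∈ Set.Icc 0 B, IsTruthfulRule B (fun z => Y y z) fun z => R y z)
    (hXY : ∀ y ∈ Set.Icc 0 B, ∀ z ∈ Set.Icc 0 B, X y z + Y y z ≤ 1)
    (hP : ∀ y ∈ Set.Icc 0 B, ∀ z ∈ Set.Icc 0 B, 0 ≤ P y z)
    (hR : ∀ y ∈ Set.Icc 0 B, ∀ z ∈ Set.Icc 0 B, 0 ≤ R y z)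
    (hTi : Integrable (fun q : ℝ × ℝ => T q.1 q.2) (μ.prod ν))
    (hT : ∀ y ∈ Set.Icc 0 B, ∀ z ∈ Set.Icc 0 B, c₀ < y → c₀ < z →
      T y z ≤ P y z + R y z + c₀ * (1 - X y z - Y y z)) :
    ∫ q, {q : ℝ × ℝ | c₀ < q.1 ∧ c₀ < q.2}.indicator (fun q => T q.1 q.2) q ∂(μ.prod ν)
      ≤ 7 / 4 * ((∫ z in Set.Ioc c₀ c₁, topRevenue μ z ∂ν)
          + ∫ y in Set.Ioc c₀ c₁, topRevenue ν y ∂μ) + excessBound μ ν c₁ := by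
  have hc₁ : c₁ ∈ Set.Icc 0 B := ⟨h0.trans h01, h1B⟩
  have hD : MeasurableSet {q : ℝ × ℝ | c₀ < q.1 ∧ c₀ < q.2} :=
    (measurableSet_lt measurable_const measurable_fst).inter
      (measurableSet_lt measurable_const measurable_snd)
  have hA : MeasurableSet {q : ℝ × ℝ | q.2 ∈ Set.Ioi c₁ ∧ q.1 ∈ Set.Ioi c₁} :=
    (measurable_snd measurableSet_Ioi).inter (measurable_fst measurableSet_Ioi)
  have hYm' : Measurable fun q : ℝ × ℝ => Y q.2 q.1 := hYm.comp measurable_swap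
  have hRm' : Measurable fun q : ℝ × ℝ => R q.2 q.1 := hRm.comp measurable_swap
  obtain ⟨i1, b1⟩ := integral_pay_add_le hμ hν h0 hsμ hXm hPm hX hP
  obtain ⟨i2, b2⟩ := integral_pay_add_le (X := fun z y => Y y z) (P := fun z y => R y z)
    hν hμ h0 hsν hYm' hRm' hY fun z hz y hy => hR y hy z hz
  obtain ⟨i3, b3⟩ := integral_excess_pay_le hμ hν hc₁ hXm hPm hX hP
  obtain ⟨i4, b4⟩ := integral_excess_pay_le (X := fun z y => Y y z) (P := fun z y => R y z)
    hν hμ hc₁ hYm' hRm' hY fun z hz y hy => hR y hy z hz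
  rw [← integral_prod_swap] at b2 b4
  have i2' := i2.swap
  have i4' := i4.swap
  have i5 : Integrable ({q : ℝ × ℝ | q.2 ∈ Set.Ioi c₁ ∧ q.1 ∈ Set.Ioi c₁}.indicator
      fun _ => c₁) (μ.prod ν) := (integrable_const _).indicator hA
  have b5 : ∫ q, {q : ℝ × ℝ | q.2 ∈ Set.Ioi c₁ ∧ q.1 ∈ Set.Ioi c₁}.indicator
      (fun _ => c₁) q ∂(μ.prod ν) = c₁ * survival μ c₁ * survival ν c₁ := by
    have : {q : ℝ × ℝ | q.2 ∈ Set.Ioi c₁ ∧ q.1 ∈ Set.Ioi c₁} = Set.Ioi c₁ ×ˢ Set.Ioi c₁ := by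
      ext q
      simp [and_comm]
    rw [integral_indicator_const _ hA, this, measureReal_prod_prod, measureReal_Ioi_eq_survival,
      measureReal_Ioi_eq_survival, smul_eq_mul]
    ring
  have hle : ∫ q, {q : ℝ × ℝ | c₀ < q.1 ∧ c₀ < q.2}.indicator (fun q => T q.1 q.2) q ∂(μ.prod ν)
      ≤ ∫ q, ({q : ℝ × ℝ | q.2 ∈ Set.Ioc c₀ c₁ ∧ q.1 ∈ Set.Ioi q.2}.indicator
            (fun q => P q.1 q.2 - q.2 * X q.1 q.2 + q.2) q
          + {q : ℝ × ℝ | q.2 ∈ Set.Ioc c₀ c₁ ∧ q.1 ∈ Set.Ioi q.2}.indicator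
            (fun q => R q.2 q.1 - q.2 * Y q.2 q.1 + q.2) q.swap
          + {q : ℝ × ℝ | q.2 ∈ Set.Ioi c₁ ∧ q.1 ∈ Set.Ioi c₁}.indicator
            (fun q => P q.1 q.2 - c₁ * X q.1 q.2) q
          + {q : ℝ × ℝ | q.2 ∈ Set.Ioi c₁ ∧ q.1 ∈ Set.Ioi c₁}.indicator
            (fun q => R q.2 q.1 - c₁ * Y q.2 q.1) q.swap
          + {q : ℝ × ℝ | q.2 ∈ Set.Ioi c₁ ∧ q.1 ∈ Set.Ioi c₁}.indicator
            (fun _ => c₁) q) ∂(μ.prod ν) := by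
    refine integral_mono_ae (hTi.indicator hD) ((((i1.add i2').add i3).add i4').add i5) ?_
    filter_upwards [ae_prod_mem_Icc hμ hν, ae_prod_ne (μ := μ) (ν := ν)] with ⟨y, z⟩ ⟨hy, hz⟩ hne
    simp only at hy hz hne
    have rX := (hX z hz).pay_le hy
    have rY := (hY y hy).pay_le hz
    have rXY := hXY y hy z hz
    have rT := hT y hy z hz
    have x0 := (hX z hz).nonneg y hy
    have y0 := (hY y hy).nonneg z hz
    simp only [Set.indicator_apply, Prod.swap,
      Set.mem_ofPred_eq, Set.mem_Ioc, Set.mem_Ioi]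
    by_cases hd : c₀ < y ∧ c₀ < z
    · rw [if_pos hd]
      have rT := rT hd.1 hd.2
      rcases lt_or_gt_of_ne hne with h | h
      · -- The bidder with value `z` is ahead.
        rcases le_or_gt y c₁ with h1 | h1
        · rw [if_neg (fun h' => absurd h (not_lt.mpr h'.2.le)), if_pos ⟨⟨hd.1, h1⟩, h⟩,
            if_neg (fun h' => absurd h'.2 (not_lt.mpr h1)),
            if_neg (fun h' => absurd h'.1 (not_lt.mpr h1)),
            if_neg (fun h' => absurd h'.2 (not_lt.mpr h1))]
          nlinarith [mul_le_mul_of_nonneg_right hd.1.le (by linarith : 0 ≤ 1 - X y z - Y y z)]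
        · have h2 : c₁ < z := h1.trans h
          rw [if_neg (fun h' => absurd h (not_lt.mpr h'.2.le)),
            if_neg (fun h' => absurd h1 (not_lt.mpr h'.1.2)),
            if_pos ⟨h2, h1⟩, if_pos ⟨h1, h2⟩, if_pos ⟨h2, h1⟩]
          nlinarith [mul_le_mul_of_nonneg_right h01 (by linarith : 0 ≤ 1 - X y z - Y y z)]
      · rcases le_or_gt z c₁ with h1 | h1
        · rw [if_pos ⟨⟨hd.2, h1⟩, h⟩, if_neg (fun h' => absurd h (not_lt.mpr h'.2.le)),
            if_neg (fun h' => absurd h'.1 (not_lt.mpr h1)),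
            if_neg (fun h' => absurd h'.2 (not_lt.mpr h1)),
            if_neg (fun h' => absurd h'.1 (not_lt.mpr h1))]
          nlinarith [mul_le_mul_of_nonneg_right hd.2.le (by linarith : 0 ≤ 1 - X y z - Y y z)]
        · have h2 : c₁ < y := h1.trans h
          rw [if_neg (fun h' => absurd h1 (not_lt.mpr h'.1.2)),
            if_neg (fun h' => absurd h (not_lt.mpr h'.2.le)),
            if_pos ⟨h1, h2⟩, if_pos ⟨h2, h1⟩, if_pos ⟨h1, h2⟩]
          nlinarith [mul_le_mul_of_nonneg_right h01 (by linarith : 0 ≤ 1 - X y z - Y y z)]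
    · rw [if_neg hd, if_neg (fun h' => hd ⟨h'.1.1.trans h'.2, h'.1.1⟩),
        if_neg (fun h' => hd ⟨h'.1.1, h'.1.1.trans h'.2⟩),
        if_neg (fun h' => hd ⟨h01.trans_lt h'.2, h01.trans_lt h'.1⟩),
        if_neg (fun h' => hd ⟨h01.trans_lt h'.1, h01.trans_lt h'.2⟩),
        if_neg (fun h' => hd ⟨h01.trans_lt h'.2, h01.trans_lt h'.1⟩)]
      simp
  refine hle.trans ?_
  have e4 := integral_add (((i1.add i2').add i3).add i4') i5
  have e3 := integral_add ((i1.add i2').add i3) i4'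
  have e2 := integral_add (i1.add i2') i3
  have e1 := integral_add i1 i2'
  simp only [Pi.add_apply, Function.comp_apply] at e1 e2 e3 e4
  rw [e4, e3, e2, e1, b5]
  unfold excessBound
  linarith

end

/-! ### The choice of the pooled interval -/

/-- The first cutoff price from `c` on at which one of the two bidders is risky. -/
noncomputable def firstRisky (μ ν : Measure ℝ) (c : ℝ) : ℝ :=
  sInf {p | c ≤ p ∧ (p ∈ riskyPrices μ ∨ p ∈ riskyPrices ν)}

open Classical in
/-- The pooled interval at a cutoff price `c` that is risky for the bidder with law `μ`: either up
to her best price, if this suffices, or between the best prices of the two bidders. -/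
noncomputable def riskyPool (μ ν : Measure ℝ) (c : ℝ) : ℝ × ℝ :=
  if 4 / 7 * excessBound μ ν c ≤
      c * survival μ c * survival ν c + 1 / 2 * (topExcess μ c * survival ν c) then
    (c, bestPrice μ c c)
  else
    (min (bestPrice μ c c) (bestPrice ν c c), max (bestPrice μ c c) (bestPrice ν c c))

open Classical in
/-- The pooled interval `[a, b)`, as the pair `(a, b)`, when two bidders are left at the cutoff
price `c`. There is no pooling if `a = b`. -/
noncomputable def pairPool (μ ν : Measure ℝ) (c : ℝ) : ℝ × ℝ :=
  if firstRisky μ ν c ∈ riskyPrices μ then riskyPool μ ν (firstRisky μ ν c)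
  else riskyPool ν μ (firstRisky μ ν c)

section

variable {μ ν : Measure ℝ} [IsProbabilityMeasure μ] [NullSingletonClass μ]
  [IsProbabilityMeasure ν] [NullSingletonClass ν] {B : ℝ}

theorem firstRisky_mem (hμ : μ (Set.Icc 0 B)ᶜ = 0) (hν : ν (Set.Icc 0 B)ᶜ = 0) (c : ℝ) :
    c ≤ firstRisky μ ν c ∧
      (firstRisky μ ν c ∈ riskyPrices μ ∨ firstRisky μ ν c ∈ riskyPrices ν) := by
  have hclosed : IsClosed {p | c ≤ p ∧ (p ∈ riskyPrices μ ∨ p ∈ riskyPrices ν)} :=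
    isClosed_Ici.inter ((isClosed_riskyPrices hμ).union (isClosed_riskyPrices hν))
  exact hclosed.csInf_mem
    ⟨max c B, le_max_left _ _, Or.inl (mem_riskyPrices_of_le hμ (le_max_right _ _))⟩
    ⟨c, fun p hp => hp.1⟩

theorem firstRisky_le {c p : ℝ} (hcp : c ≤ p) (hp : p ∈ riskyPrices μ ∨ p ∈ riskyPrices ν) :
    firstRisky μ ν c ≤ p := csInf_le ⟨c, fun _ hp => hp.1⟩ ⟨hcp, hp⟩

theorem firstRisky_mono (hμ : μ (Set.Icc 0 B)ᶜ = 0) (hν : ν (Set.Icc 0 B)ᶜ = 0) :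
    Monotone (firstRisky μ ν) := fun _ c' h =>
  firstRisky_le (h.trans (firstRisky_mem hμ hν c').1) (firstRisky_mem hμ hν c').2

theorem measurable_riskyPool (hμ : μ (Set.Icc 0 B)ᶜ = 0) (hν : ν (Set.Icc 0 B)ᶜ = 0) :
    Measurable (riskyPool μ ν) := by
  have h1 := (continuous_survival μ).measurable
  have h2 := (continuous_survival ν).measurable
  have h3 := (continuous_topExcess hμ).measurable
  have h4 := (continuous_topExcess hν).measurable
  have h5 := (monotone_bestPrice_self hμ).measurable
  have h6 := (monotone_bestPrice_self hν).measurable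
  unfold riskyPool excessBound
  refine Measurable.ite (measurableSet_le (by fun_prop) (by fun_prop)) (by fun_prop) ?_
  exact (h5.min h6).prodMk (h5.max h6)

theorem measurable_pairPool (hμ : μ (Set.Icc 0 B)ᶜ = 0) (hν : ν (Set.Icc 0 B)ᶜ = 0) :
    Measurable (pairPool μ ν) := by
  have h := (firstRisky_mono hμ hν).measurable
  exact Measurable.ite (h (isClosed_riskyPrices hμ).measurableSet)
    ((measurable_riskyPool hμ hν).comp h) ((measurable_riskyPool hν hμ).comp h)

theorem riskyPool_mem (hμ : μ (Set.Icc 0 B)ᶜ = 0) (hν : ν (Set.Icc 0 B)ᶜ = 0) (c : ℝ) :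
    c ≤ (riskyPool μ ν c).1 ∧ (riskyPool μ ν c).1 ≤ (riskyPool μ ν c).2 := by
  have h1 := le_bestPrice hμ (le_refl c)
  have h2 := le_bestPrice hν (le_refl c)
  unfold riskyPool
  split_ifs
  · exact ⟨le_rfl, h1⟩
  · exact ⟨le_min h1 h2, min_le_max⟩

theorem pairPool_mem (hμ : μ (Set.Icc 0 B)ᶜ = 0) (hν : ν (Set.Icc 0 B)ᶜ = 0) (c : ℝ) :
    c ≤ (pairPool μ ν c).1 ∧ (pairPool μ ν c).1 ≤ (pairPool μ ν c).2 := by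
  have h := (firstRisky_mem hμ hν c).1
  unfold pairPool
  split_ifs
  · exact ⟨h.trans (riskyPool_mem hμ hν _).1, (riskyPool_mem hμ hν _).2⟩
  · exact ⟨h.trans (riskyPool_mem hν hμ _).1, (riskyPool_mem hν hμ _).2⟩

theorem mul_survival_sub_le_integral (hμ : μ (Set.Icc 0 B)ᶜ = 0) {c a p : ℝ} (hc : 0 ≤ c)
    (hca : c ≤ a) (hap : a ≤ p) :
    p * survival μ p * (survival ν c - survival ν a) ≤ ∫ z in Set.Ioc c a, topRevenue μ z ∂ν := by
  have h : ν.real (Set.Ioc c a) = survival ν c - survival ν a := by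
    rw [← measureReal_Ico_eq_survival ν hca, measureReal_def, measureReal_def,
      measure_congr Ico_ae_eq_Ioc]
  rw [← h, mul_comm, ← smul_eq_mul, ← setIntegral_const]
  refine setIntegral_mono_on (integrable_const _)
    (integrableOn_topRevenue hμ measurableSet_Ioc fun z hz => hc.trans hz.1.le)
    measurableSet_Ioc fun z hz => ?_
  exact mul_survival_le_topRevenue hμ (hc.trans hz.1.le) (hz.2.trans hap)

theorem setIntegral_topRevenue_nonneg (hμ : μ (Set.Icc 0 B)ᶜ = 0) {c a : ℝ} (hc : 0 ≤ c) :
    0 ≤ ∫ z in Set.Ioc c a, topRevenue μ z ∂ν :=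
  setIntegral_nonneg measurableSet_Ioc fun _ hz => topRevenue_nonneg hμ (hc.trans hz.1.le)

theorem bestPrice_mul_survival (μ : Measure ℝ) (c : ℝ) :
    bestPrice μ c c * survival μ (bestPrice μ c c)
      = topExcess μ c + c * survival μ (bestPrice μ c c) := by
  unfold topExcess
  ring

/-- Letting the price rise up to the lower one of the two best prices and pooling up to the higher
one. -/
theorem le_poolingBound_min_max (hμ : μ (Set.Icc 0 B)ᶜ = 0) (hν : ν (Set.Icc 0 B)ᶜ = 0) {c : ℝ}
    (hc : 0 ≤ c) (h : bestPrice μ c c ≤ bestPrice ν c c) :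
    bestPrice μ c c * survival μ (bestPrice μ c c) * survival ν c
        + bestPrice ν c c * survival ν (bestPrice ν c c) * survival μ c
        - 1 / 2 * (bestPrice μ c c * survival μ (bestPrice μ c c) * survival ν (bestPrice ν c c)
          + bestPrice ν c c * survival ν (bestPrice ν c c) * survival μ (bestPrice μ c c))
      ≤ poolingBound μ ν c (bestPrice μ c c) (bestPrice ν c c) := by
  have h1 := mul_survival_sub_le_integral (ν := ν) hμ hc (le_bestPrice hμ (le_refl c)) le_rfl
  have h2 := mul_survival_sub_le_integral (ν := μ) hν hc (le_bestPrice hμ (le_refl c)) h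
  have h3 := mul_le_mul_of_nonneg_left (le_max_right
    (survival μ (bestPrice ν c c) * survival ν (bestPrice μ c c))
    (survival ν (bestPrice ν c c) * survival μ (bestPrice μ c c)))
    (mul_nonneg one_half_pos.le (sub_nonneg.mpr h))
  unfold poolingBound
  linarith

theorem excessBound_le_poolingBound_riskyPool (hμ : μ (Set.Icc 0 B)ᶜ = 0)
    (hν : ν (Set.Icc 0 B)ᶜ = 0) {c : ℝ} (hc : 0 ≤ c) (hr : c ∈ riskyPrices μ) :
    4 / 7 * excessBound μ ν c
      ≤ poolingBound μ ν c (riskyPool μ ν c).1 (riskyPool μ ν c).2 := by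
  have hμP := le_bestPrice hμ (le_refl c)
  have hνP := le_bestPrice hν (le_refl c)
  unfold riskyPool
  split_ifs with hX
  · refine hX.trans ?_
    have h3 := mul_le_mul_of_nonneg_left (le_max_left
      (survival μ (bestPrice μ c c) * survival ν c) (survival ν (bestPrice μ c c) * survival μ c))
      (mul_nonneg one_half_pos.le (sub_nonneg.mpr hμP))
    have h4 := setIntegral_topRevenue_nonneg (ν := ν) (a := c) hμ hc
    have h5 := setIntegral_topRevenue_nonneg (ν := μ) (a := c) hν hc
    unfold poolingBound topExcess
    linarith
  · have hc0 : 0 < c := hc.lt_of_ne fun h => zero_notMem_riskyPrices hμ (h ▸ hr)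
    have hw := topExcess_nonneg hμ c
    have hw' := topExcess_nonneg hν c
    -- If one of the bidders cannot be active, all of the bounds vanish.
    have hQ : 0 < survival μ c := by
      refine (survival_nonneg μ c).lt_of_ne fun h => hX ?_
      simp [excessBound, ← h, topExcess_eq_zero hμ h.symm]
    have hQ' : 0 < survival ν c := by
      refine (survival_nonneg ν c).lt_of_ne fun h => hX ?_
      simp [excessBound, ← h, topExcess_eq_zero hν h.symm]
    have r1 := topRevenue_le_of_mem_riskyPrices hμ hc hr
    have r2 := mul_survival_le_topRevenue hμ hc (le_refl c)
    have r3 := topExcess_add_le_topRevenue hμ hc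
    have key := four_sevenths_le_of_risky_homogeneous hc0 hQ hQ'
      (survival_nonneg μ (bestPrice μ c c)) (survival_nonneg ν (bestPrice ν c c)) hw'
      (by linarith) (by linarith) (not_le.mp hX)
    refine key.trans ?_
    rw [← bestPrice_mul_survival, ← bestPrice_mul_survival]
    rcases le_total (bestPrice μ c c) (bestPrice ν c c) with h | h
    · simpa [min_eq_left h, max_eq_right h] using le_poolingBound_min_max hμ hν hc h
    · have := le_poolingBound_min_max hν hμ hc h
      rw [poolingBound_comm] at this
      simp only [min_eq_right h, max_eq_left h]
      linarith

theorem excessBound_le_poolingBound_pairPool (hμ : μ (Set.Icc 0 B)ᶜ = 0)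
    (hν : ν (Set.Icc 0 B)ᶜ = 0) {c : ℝ} (hc : 0 ≤ c) :
    4 / 7 * excessBound μ ν (firstRisky μ ν c)
      ≤ poolingBound μ ν (firstRisky μ ν c) (pairPool μ ν c).1 (pairPool μ ν c).2 := by
  have h := firstRisky_mem hμ hν c
  unfold pairPool
  split_ifs with hr
  · exact excessBound_le_poolingBound_riskyPool hμ hν (hc.trans h.1) hr
  · rw [excessBound_comm, poolingBound_comm]
    exact excessBound_le_poolingBound_riskyPool hν hμ (hc.trans h.1) (h.2.resolve_left hr)

theorem poolingBound_add (hμ : μ (Set.Icc 0 B)ᶜ = 0) (hν : ν (Set.Icc 0 B)ᶜ = 0)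
    {c₀ c₁ a b : ℝ} (hc : 0 ≤ c₀) (h01 : c₀ ≤ c₁) (h1a : c₁ ≤ a) :
    poolingBound μ ν c₀ a b = ((∫ z in Set.Ioc c₀ c₁, topRevenue μ z ∂ν)
      + ∫ y in Set.Ioc c₀ c₁, topRevenue ν y ∂μ) + poolingBound μ ν c₁ a b := by
  have split : ∀ (α β : Measure ℝ) [IsProbabilityMeasure α] [NullSingletonClass α]
      [IsProbabilityMeasure β] [NullSingletonClass β], α (Set.Icc 0 B)ᶜ = 0 →
      ∫ z in Set.Ioc c₀ a, topRevenue α z ∂β = (∫ z in Set.Ioc c₀ c₁, topRevenue α z ∂β)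
        + ∫ z in Set.Ioc c₁ a, topRevenue α z ∂β := by
    intro α β _ _ _ _ hα
    rw [← Set.Ioc_union_Ioc_eq_Ioc h01 h1a]
    refine setIntegral_union (Set.Ioc_disjoint_Ioc_of_le le_rfl) measurableSet_Ioc ?_ ?_
    · exact integrableOn_topRevenue hα measurableSet_Ioc fun z hz => hc.trans hz.1.le
    · exact integrableOn_topRevenue hα measurableSet_Ioc fun z hz => (hc.trans h01).trans hz.1.le
  unfold poolingBound
  rw [split μ ν hμ, split ν μ hν]
  ring

/-- The revenue when two bidders with values `y` and `z` are left, if the values in `[a, b)` are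
pooled. -/
noncomputable def twoBidderRevenue (μ ν : Measure ℝ) (a b y z : ℝ) : ℝ :=
  if z < y then pairRevenue (lastPrice μ) a b y z else pairRevenue (lastPrice ν) a b z y

theorem poolingBound_le_integral_twoBidderRevenue (hμ : μ (Set.Icc 0 B)ᶜ = 0)
    (hν : ν (Set.Icc 0 B)ᶜ = 0) {a b c : ℝ} (hc : 0 ≤ c) (hca : c ≤ a) (hab : a ≤ b) :
    poolingBound μ ν c a b ≤ ∫ q, {q : ℝ × ℝ | c < q.1 ∧ c < q.2}.indicator
      (fun q => twoBidderRevenue μ ν a b q.1 q.2) q ∂(μ.prod ν) := by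
  refine (poolingBound_le hμ hν hc hca hab).trans_eq ?_
  have i1 := integrable_region_pairRevenue hμ hν (hc.trans hca) b c
  have i2 := (integrable_region_pairRevenue hν hμ (hc.trans hca) b c).swap
  rw [← integral_prod_swap (μ := ν) (ν := μ)]
  refine (integral_add i1 i2).symm.trans (integral_congr_ae ?_)
  filter_upwards [ae_prod_ne (μ := μ) (ν := ν)] with ⟨y, z⟩ hne
  simp only at hne
  simp only [Set.indicator_apply, Prod.swap, Function.comp_apply, Set.mem_ofPred_eq, Set.mem_Ioi,
    twoBidderRevenue]
  rcases lt_or_gt_of_ne hne with h | h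
  · by_cases hc' : c < y
    · simp [hc', h, h.not_gt, hc'.trans h]
    · simp [hc', h.not_gt]
  · by_cases hc' : c < z
    · simp [hc', h, h.not_gt, hc'.trans h]
    · simp [hc', h.not_gt]

/-- The guarantee for two bidders, conditional on the values of all others. -/
theorem integral_totalPayment_le_twoBidderRevenue (hμ : μ (Set.Icc 0 B)ᶜ = 0)
    (hν : ν (Set.Icc 0 B)ᶜ = 0) {c : ℝ} (hc : c ∈ Set.Icc 0 B)
    {X Y P R T : ℝ → ℝ → ℝ}
    (hXm : Measurable fun q : ℝ × ℝ => X q.1 q.2) (hYm : Measurable fun q : ℝ × ℝ => Y q.1 q.2)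
    (hPm : Measurable fun q : ℝ × ℝ => P q.1 q.2) (hRm : Measurable fun q : ℝ × ℝ => R q.1 q.2)
    (hX : ∀ z ∈ Set.Icc 0 B, IsTruthfulRule B (fun y => X y z) fun y => P y z)
    (hY : ∀ y ∈ Set.Icc 0 B, IsTruthfulRule B (fun z => Y y z) fun z => R y z)
    (hXY : ∀ y ∈ Set.Icc 0 B, ∀ z ∈ Set.Icc 0 B, X y z + Y y z ≤ 1)
    (hP : ∀ y ∈ Set.Icc 0 B, ∀ z ∈ Set.Icc 0 B, 0 ≤ P y z)
    (hR : ∀ y ∈ Set.Icc 0 B, ∀ z ∈ Set.Icc 0 B, 0 ≤ R y z)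
    (hTi : Integrable (fun q : ℝ × ℝ => T q.1 q.2) (μ.prod ν))
    (hT : ∀ y ∈ Set.Icc 0 B, ∀ z ∈ Set.Icc 0 B, c < y → c < z →
      T y z ≤ P y z + R y z + c * (1 - X y z - Y y z)) :
    4 / 7 * ∫ q, {q : ℝ × ℝ | c < q.1 ∧ c < q.2}.indicator (fun q => T q.1 q.2) q ∂(μ.prod ν)
      ≤ ∫ q, {q : ℝ × ℝ | c < q.1 ∧ c < q.2}.indicator
        (fun q => twoBidderRevenue μ ν (pairPool μ ν c).1 (pairPool μ ν c).2 q.1 q.2) q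
          ∂(μ.prod ν) := by
  have hf := firstRisky_mem hμ hν c
  have hp := pairPool_mem hμ hν c
  have hfp : firstRisky μ ν c ≤ (pairPool μ ν c).1 := by
    unfold pairPool
    split_ifs
    · exact (riskyPool_mem hμ hν _).1
    · exact (riskyPool_mem hν hμ _).1
  have hnot : ∀ z ∈ Set.Ico c (firstRisky μ ν c), ¬ (z ∈ riskyPrices μ ∨ z ∈ riskyPrices ν) :=
    fun z hz h => not_le.mpr hz.2 (firstRisky_le hz.1 h)
  have h1 := integral_totalPayment_le hμ hν hc.1 hf.1
    (firstRisky_le hc.2 (Or.inl (mem_riskyPrices_of_le hμ le_rfl)))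
    (fun z hz h => hnot z hz (Or.inl h)) (fun z hz h => hnot z hz (Or.inr h))
    hXm hYm hPm hRm hX hY hXY hP hR hTi hT
  have h2 := excessBound_le_poolingBound_pairPool hμ hν hc.1
  have h3 := poolingBound_le_integral_twoBidderRevenue hμ hν hc.1 hp.1 hp.2
  rw [poolingBound_add hμ hν hc.1 hf.1 hfp] at h3
  linarith

end

/-! ### The auction and its payments -/

section

variable {ι : Type*} [DecidableEq ι]

open Classical in
/-- The pooled interval when `S` is the set of active bidders at the cutoff price `c`. It is only
meaningful when `S` consists of two bidders; these are put into an arbitrary but fixed order. -/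
noncomputable def activePool (F : ι → Measure ℝ) (S : Finset ι) (c : ℝ) : ℝ × ℝ :=
  if h : ∃ p : ι × ι, p.1 ≠ p.2 ∧ S = {p.1, p.2} then
    pairPool (F h.choose.1) (F h.choose.2) c
  else (c, c)

theorem exists_activePool_eq (F : ι → Measure ℝ) {S : Finset ι} (hS : S.card = 2) :
    ∃ i j, i ≠ j ∧ S = {i, j} ∧ ∀ c, activePool F S c = pairPool (F i) (F j) c := by
  have h : ∃ p : ι × ι, p.1 ≠ p.2 ∧ S = {p.1, p.2} := by
    obtain ⟨x, y, hxy, hS⟩ := Finset.card_eq_two.mp hS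
    exact ⟨(x, y), hxy, hS⟩
  exact ⟨h.choose.1, h.choose.2, h.choose_spec.1, h.choose_spec.2, fun c => dif_pos h⟩

/-- The plan without jumps, except that the values in the interval given by `activePool` are pooled
if two bidders are active. -/
noncomputable def poolingPlan (F : ι → Measure ℝ) (S : Finset ι) (c : ℝ) : RaisePlan c where
  jumps := {I | S.card = 2 ∧ I = activePool F S c ∧ c ≤ I.1 ∧ I.1 < I.2}
  le_start _ hI := hI.2.2.1
  start_lt _ hI := hI.2.2.2
  disjoint := fun _ hI _ hJ hne => absurd (hI.2.1.trans hJ.2.1.symm) hne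
  wf := ((Set.finite_singleton (activePool F S c)).subset fun _ hI => hI.2.1).image _ |>.isWF

/-- The auction that raises the price continuously until two bidders are left, and from then on
pools the values in the interval given by `activePool`. -/
noncomputable def poolingAuction {F : ι → Measure ℝ} [∀ i, IsProbabilityMeasure (F i)]
    [∀ i, NullSingletonClass (F i)] {B : ℝ} (hF : ∀ i, F i (Set.Icc 0 B)ᶜ = 0) : LAP F where
  plan _ S c := poolingPlan F S c
  price i c := lastPrice (F i) c
  price_optimal i c hc := by
    rw [lastPrice_of_nonneg hc]
    exact isOptimalPrice_bestPrice (hF i) hc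

variable {F : ι → Measure ℝ} [∀ i, IsProbabilityMeasure (F i)]
    [∀ i, NullSingletonClass (F i)] {B : ℝ} (hF : ∀ i, F i (Set.Icc 0 B)ᶜ = 0)

theorem LAP.run_singleton (A : LAP F) (v : ι → ℝ) (h : AuctionHistory ι) (i : ι) (c : ℝ) :
    A.run v h {i} c = AuctionOutcome.postedPrice i (v i) (A.price i c) := by
  have hex : ∃ k, ({i} : Finset ι) = {k} := ⟨i, rfl⟩
  have hi : hex.choose = i := (Finset.singleton_injective hex.choose_spec).symm
  rw [LAP.run, dif_neg (by simp), dif_pos hex, hi]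

theorem LAP.run_of_not_jump (A : LAP F) (v : ι → ℝ) (h : AuctionHistory ι) {S : Finset ι}
    (c : ℝ) (hS : 2 ≤ S.card) (hne : S.Nonempty)
    (hJ : ¬ ∃ I ∈ (A.plan h S c).jumps, S.inf' hne v ∈ Set.Ico I.1 I.2) :
    A.run v h S c = A.run v ((above v S (S.inf' hne v), S.inf' hne v, S.inf' hne v) :: h)
      (above v S (S.inf' hne v)) (S.inf' hne v) := by
  rw [LAP.run, dif_pos hS]
  exact dif_neg hJ

/-- When more than two bidders are active, the price rises to the highest value outside of the
two highest ones. -/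
theorem exists_run_poolingAuction_eq (v : ι → ℝ) {T : Finset ι} (hT : T.card = 2) :
    ∀ (n : ℕ) (S : Finset ι) (h : AuctionHistory ι) (c : ℝ), S.card = n → T ⊆ S →
      (S \ T).Nonempty → (∀ i ∈ T, ∀ l ∈ S \ T, v l < v i) →
      ∃ h' c', (poolingAuction hF).run v h S c = (poolingAuction hF).run v h' T c' ∧
        (∃ l ∈ S \ T, v l = c') ∧ ∀ l ∈ S \ T, v l ≤ c' := by
  intro n
  induction n using Nat.strong_induction_on with
  | _ n ih =>
    intro S h c hn hTS hne hlt
    have hcard : 2 < S.card := by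
      have h1 := Finset.card_sdiff_add_card_eq_card hTS
      have h2 := hne.card_pos
      omega
    have hSne : S.Nonempty := Finset.card_pos.mp (by omega)
    set m := S.inf' hSne v with hm
    have hrun := LAP.run_of_not_jump (poolingAuction hF) v h c hcard.le hSne
      (by rintro ⟨I, hI, -⟩; exact absurd hI.1 (by omega))
    rw [← hm] at hrun
    obtain ⟨l₀, hl₀⟩ := hne
    have hmT : ∀ i ∈ T, m < v i := fun i hi =>
      (Finset.inf'_le v (Finset.mem_sdiff.mp hl₀).1).trans_lt (hlt i hi l₀ hl₀)
    have hTS' : T ⊆ LAP.above v S m := fun i hi =>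
      Finset.mem_filter.mpr ⟨hTS hi, hmT i hi⟩
    have hss : LAP.above v S m ⊂ S := LAP.above_ssubset v S hSne
    rcases (LAP.above v S m \ T).eq_empty_or_nonempty with he | hne'
    · have heq : LAP.above v S m = T := (Finset.sdiff_eq_empty_iff_subset.mp he).antisymm hTS'
      rw [heq] at hrun
      have hle : ∀ l ∈ S \ T, v l ≤ m := by
        intro l hl
        by_contra! hlm
        exact (Finset.mem_sdiff.mp hl).2
          (heq ▸ Finset.mem_filter.mpr ⟨(Finset.mem_sdiff.mp hl).1, hlm⟩)
      refine ⟨_, m, hrun, ⟨l₀, hl₀, ?_⟩, hle⟩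
      exact le_antisymm (hle l₀ hl₀) (Finset.inf'_le v (Finset.mem_sdiff.mp hl₀).1)
    · have hsub : ∀ l ∈ LAP.above v S m \ T, l ∈ S \ T := fun l hl =>
        Finset.sdiff_subset_sdiff hss.subset le_rfl hl
      obtain ⟨h', c', hr, ⟨l, hl, hlc⟩, hmax⟩ := ih _ (hn ▸ Finset.card_lt_card hss)
        (LAP.above v S m) ((LAP.above v S m, m, m) :: h) m rfl hTS' hne'
        fun i hi l hl => hlt i hi l (hsub l hl)
      refine ⟨h', c', hrun.trans hr, ⟨l, hsub l hl, hlc⟩, fun k hk => ?_⟩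
      by_cases hkm : m < v k
      · exact hmax k (Finset.mem_sdiff.mpr ⟨Finset.mem_filter.mpr
          ⟨(Finset.mem_sdiff.mp hk).1, hkm⟩, (Finset.mem_sdiff.mp hk).2⟩)
      · have := (Finset.mem_filter.mp (Finset.mem_sdiff.mp hl).1).2
        linarith [not_lt.mp hkm]

variable [Fintype ι]

theorem sum_pay_postedPrice (i : ι) (x p : ℝ) :
    ∑ l, (AuctionOutcome.postedPrice i x p).pay l = if p ≤ x then p else 0 := by
  unfold AuctionOutcome.postedPrice
  split_ifs <;> simp [AuctionOutcome.single, AuctionOutcome.unsold]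

theorem sum_pay_menu (i : ι) (x a r : ℝ) :
    ∑ l, (AuctionOutcome.menu i x 2 a r).pay l
      = 1 / 2 * a + if r ≤ x then 1 / 2 * r else 0 := by
  unfold AuctionOutcome.menu
  split_ifs
  · simp only [AuctionOutcome.single, Finset.sum_pi_single', Finset.mem_univ, if_true]
    norm_num
  · simp [AuctionOutcome.single]

theorem sum_pay_lottery {S : Finset ι} (hS : S.Nonempty) (a : ℝ) :
    ∑ l, (AuctionOutcome.lottery S a).pay l = a := by
  have : (S.card : ℝ) ≠ 0 := by exact_mod_cast hS.card_pos.ne'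
  simp only [AuctionOutcome.lottery, Finset.sum_ite_mem, Finset.univ_inter, Finset.sum_const,
    nsmul_eq_mul]
  field_simp

theorem sum_pay_run_pair (v : ι → ℝ) (h : AuctionHistory ι) {i j : ι} (hij : v j < v i) (c : ℝ)
    (hc : c ≤ (activePool F {i, j} c).1) :
    ∑ l, ((poolingAuction hF).run v h {i, j} c).pay l
      = pairRevenue (lastPrice (F i)) (activePool F {i, j} c).1 (activePool F {i, j} c).2
        (v i) (v j) := by
  have hne : i ≠ j := fun h => by simp [h] at hij
  have hcard : ({i, j} : Finset ι).card = 2 := Finset.card_pair hne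
  have hne' : ({i, j} : Finset ι).Nonempty := ⟨i, by simp⟩
  have hm : ({i, j} : Finset ι).inf' hne' v = v j := by
    refine le_antisymm (Finset.inf'_le v (by simp)) (Finset.le_inf' _ _ fun l hl => ?_)
    rcases Finset.mem_insert.mp hl with rfl | hl
    · exact hij.le
    · rw [Finset.mem_singleton.mp hl]
  set I := activePool F {i, j} c with hI
  by_cases hJ : I.1 ≤ v j ∧ v j < I.2
  · have hex : ∃ J ∈ ((poolingAuction hF).plan h {i, j} c).jumps,
        ({i, j} : Finset ι).inf' hne' v ∈ Set.Ico J.1 J.2 :=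
      ⟨I, ⟨hcard, rfl, hc, hJ.1.trans_lt hJ.2⟩, by rw [hm]; exact hJ⟩
    have hch : hex.choose = I := hex.choose_spec.1.2.1
    have hjb : j ∉ LAP.atLeast v {i, j} I.2 := fun h' =>
      absurd (Finset.mem_filter.mp h').2 (not_le.mpr hJ.2)
    rw [LAP.run, dif_pos hcard.ge]
    simp only [dif_pos hex, hch, pairRevenue, hJ, and_self, if_true]
    by_cases hib : v i < I.2
    · have he : LAP.atLeast v {i, j} I.2 = ∅ := by
        refine Finset.filter_eq_empty_iff.mpr fun l hl => ?_
        rcases Finset.mem_insert.mp hl with rfl | hl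
        · exact not_le.mpr hib
        · rw [Finset.mem_singleton.mp hl]
          exact not_le.mpr hJ.2
      rw [if_pos he, if_pos hib, sum_pay_lottery hne']
    · have he : LAP.atLeast v {i, j} I.2 = {i} := by
        refine Finset.eq_singleton_iff_unique_mem.mpr
          ⟨Finset.mem_filter.mpr ⟨by simp, not_lt.mp hib⟩, fun l hl => ?_⟩
        rcases Finset.mem_insert.mp (Finset.mem_filter.mp hl).1 with h' | h'
        · exact h'
        · exact absurd (Finset.mem_singleton.mp h' ▸ hl) hjb
      have hex1 : ∃ k, LAP.atLeast v {i, j} I.2 = {k} := ⟨i, he⟩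
      have hi : hex1.choose = i :=
        Finset.singleton_injective (hex1.choose_spec.symm.trans he)
      rw [if_neg (by rw [he]; exact Finset.singleton_ne_empty i), dif_pos hex1, if_neg hib, hi,
        hcard, sum_pay_menu]
      rfl
  · have habove : LAP.above v {i, j} (v j) = {i} := by
      refine Finset.eq_singleton_iff_unique_mem.mpr
        ⟨Finset.mem_filter.mpr ⟨by simp, hij⟩, fun l hl => ?_⟩
      have hl' := Finset.mem_filter.mp hl
      rcases Finset.mem_insert.mp hl'.1 with h' | h'
      · exact h'
      · rw [Finset.mem_singleton.mp h'] at hl'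
        exact absurd hl'.2 (lt_irrefl _)
    rw [LAP.run_of_not_jump _ v h c hcard.ge hne' (by
      rintro ⟨J, hJ', hmJ⟩
      rw [hm, hJ'.2.1] at hmJ
      exact hJ hmJ), hm, habove, LAP.run_singleton, sum_pay_postedPrice, pairRevenue, if_neg hJ]
    rfl

/-- The highest value outside of `T`, or `0` if there is none. -/
noncomputable def highestOutside (T : Finset ι) (v : ι → ℝ) : ℝ :=
  ((Tᶜ.sup fun l => (v l).toNNReal : NNReal) : ℝ)

theorem highestOutside_nonneg (T : Finset ι) (v : ι → ℝ) : 0 ≤ highestOutside T v :=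
  NNReal.coe_nonneg _

theorem le_highestOutside {T : Finset ι} (v : ι → ℝ) {l : ι} (hl : l ∉ T) :
    v l ≤ highestOutside T v :=
  (Real.le_coe_toNNReal (v l)).trans (NNReal.coe_le_coe.mpr
    (Finset.le_sup (f := fun l => (v l).toNNReal) (Finset.mem_compl.mpr hl)))

theorem highestOutside_le {T : Finset ι} {v : ι → ℝ} {c : ℝ} (hc : 0 ≤ c)
    (h : ∀ l, l ∉ T → v l ≤ c) : highestOutside T v ≤ c := by
  have : (Tᶜ.sup fun l => (v l).toNNReal : NNReal) ≤ c.toNNReal :=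
    Finset.sup_le fun l hl => Real.toNNReal_le_toNNReal (h l (Finset.mem_compl.mp hl))
  exact (NNReal.coe_le_coe.mpr this).trans_eq (Real.coe_toNNReal c hc)

theorem measurable_highestOutside (T : Finset ι) : Measurable (highestOutside (ι := ι) T) := by
  refine measurable_coe_nnreal_real.comp ?_
  have : (fun v : ι → ℝ => (Tᶜ.sup fun l => (v l).toNNReal : NNReal))
      = Tᶜ.sup fun l => fun v : ι → ℝ => (v l).toNNReal := by
    funext v
    rw [Finset.sup_apply]
  rw [this]
  exact Finset.sup_induction measurable_const (fun _ hf _ hg => hf.sup hg)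
    fun l _ => (measurable_pi_apply l).real_toNNReal

/-- The payments in the auction when `T` consists of the two bidders with the highest values. -/
theorem totalPayment_poolingAuction {T : Finset ι} (hT : T.card = 2) {v : ι → ℝ}
    (hv : ∀ l, 0 ≤ v l) (hvT : ∀ i ∈ T, highestOutside T v < v i) {i j : ι} (hTij : T = {i, j})
    (hij : v i ≠ v j)
    (hpool : highestOutside T v ≤ (activePool F T (highestOutside T v)).1) :
    (poolingAuction hF).toMechanism.totalPayment v
      = twoBidderRevenue (F i) (F j) (activePool F T (highestOutside T v)).1
        (activePool F T (highestOutside T v)).2 (v i) (v j) := by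
  have hat : LAP.atLeast v Finset.univ 0 = Finset.univ := by
    simp [LAP.atLeast, hv]
  obtain ⟨h', hrun⟩ : ∃ h', (poolingAuction hF).run v [] Finset.univ 0
      = (poolingAuction hF).run v h' T (highestOutside T v) := by
    rcases (Finset.univ \ T).eq_empty_or_nonempty with he | hne
    · have hTu : T = Finset.univ :=
        (Finset.subset_univ T).antisymm (Finset.sdiff_eq_empty_iff_subset.mp he)
      refine ⟨[], ?_⟩
      rw [hTu]
      simp [highestOutside]
    · obtain ⟨h', c', hr, ⟨l, hl, hlc⟩, hmax⟩ := exists_run_poolingAuction_eq hF v hT _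
        Finset.univ [] 0 rfl (Finset.subset_univ T) hne fun i hi l hl =>
          (le_highestOutside v (Finset.mem_sdiff.mp hl).2).trans_lt (hvT i hi)
      have hc' : c' = highestOutside T v := by
        refine le_antisymm (hlc ▸ le_highestOutside v (Finset.mem_sdiff.mp hl).2) ?_
        exact highestOutside_le (hlc ▸ hv l) fun k hk =>
          hmax k (Finset.mem_sdiff.mpr ⟨Finset.mem_univ k, hk⟩)
      exact ⟨h', hc' ▸ hr⟩
  have hpay : (poolingAuction hF).toMechanism.totalPayment v
      = ∑ l, ((poolingAuction hF).run v h' T (highestOutside T v)).pay l := by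
    rw [← hrun]
    simp only [DirectMechanism.totalPayment, LAP.toMechanism, hat]
  rw [hpay]
  subst hTij
  unfold twoBidderRevenue
  rcases lt_or_gt_of_ne hij with h | h
  · rw [if_neg h.not_gt]
    have hpool' := hpool
    rw [Finset.pair_comm] at hpool ⊢
    exact sum_pay_run_pair hF v h' h _ hpool
  · rw [if_pos h]
    exact sum_pay_run_pair hF v h' h _ hpool

end

/-! ### Resampling coordinates of a product measure -/

section

variable {ι : Type*} [Fintype ι] [DecidableEq ι] {F : ι → Measure ℝ}
  [∀ i, IsProbabilityMeasure (F i)]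

theorem measurePreserving_update (i : ι) :
    MeasurePreserving (fun q : (ι → ℝ) × ℝ => Function.update q.1 i q.2)
      ((Measure.pi F).prod (F i)) (Measure.pi F) := by
  have hm : Measurable fun q : (ι → ℝ) × ℝ => Function.update q.1 i q.2 := measurable_update'
  refine ⟨hm, (Measure.pi_eq fun s hs => ?_).symm⟩
  rw [Measure.map_apply hm (MeasurableSet.univ_pi hs)]
  have : (fun q : (ι → ℝ) × ℝ => Function.update q.1 i q.2) ⁻¹' Set.univ.pi s
      = (Set.univ.pi (Function.update s i Set.univ)) ×ˢ s i := by
    ext ⟨v, y⟩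
    simp only [Set.mem_preimage, Set.mem_univ_pi, Set.mem_prod]
    constructor
    · intro h
      refine ⟨fun l => ?_, by simpa using h i⟩
      rcases eq_or_ne l i with rfl | hl
      · simp
      · simpa [hl] using h l
    · rintro ⟨h, hy⟩ l
      rcases eq_or_ne l i with rfl | hl
      · simpa using hy
      · simpa [hl] using h l
  rw [this, Measure.prod_prod, Measure.pi_pi, ← Finset.mul_prod_erase _ _ (Finset.mem_univ i),
    ← Finset.mul_prod_erase _ _ (Finset.mem_univ i), Function.update_self, measure_univ, one_mul,
    mul_comm]
  congr 1
  refine Finset.prod_congr rfl fun l hl => ?_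
  rw [Function.update_of_ne (Finset.ne_of_mem_erase hl)]

/-- Replace the coordinates `i` and `j` of `v` by `y` and `z`. -/
def updatePair (i j : ι) (v : ι → ℝ) (y z : ℝ) : ι → ℝ :=
  Function.update (Function.update v i y) j z

theorem measurable_updatePair (i j : ι) :
    Measurable fun q : (ι → ℝ) × ℝ × ℝ => updatePair i j q.1 q.2.1 q.2.2 := by
  have h : Measurable fun q : (ι → ℝ) × ℝ => Function.update q.1 i q.2 := measurable_update'
  have h' : Measurable fun q : (ι → ℝ) × ℝ => Function.update q.1 j q.2 := measurable_update'
  exact h'.comp ((h.comp (measurable_fst.prodMk measurable_snd.fst)).prodMk measurable_snd.snd)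

theorem measurePreserving_updatePair (i j : ι) :
    MeasurePreserving (fun q : (ι → ℝ) × ℝ × ℝ => updatePair i j q.1 q.2.1 q.2.2)
      ((Measure.pi F).prod ((F i).prod (F j))) (Measure.pi F) := by
  have h1 : MeasurePreserving (fun q : ((ι → ℝ) × ℝ) × ℝ => (Function.update q.1.1 i q.1.2, q.2))
      (((Measure.pi F).prod (F i)).prod (F j)) ((Measure.pi F).prod (F j)) :=
    (measurePreserving_update i).prod (MeasurePreserving.id _)
  exact ((measurePreserving_update j).comp h1).comp (measurePreserving_prodAssoc _ _ _).symm

theorem integral_pi_eq_updatePair (i j : ι) {f : (ι → ℝ) → ℝ} (hf : Integrable f (Measure.pi F)) :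
    Integrable (fun v => ∫ q : ℝ × ℝ, f (updatePair i j v q.1 q.2) ∂((F i).prod (F j)))
        (Measure.pi F) ∧
      ∫ v, f v ∂(Measure.pi F)
        = ∫ v, ∫ q : ℝ × ℝ, f (updatePair i j v q.1 q.2) ∂((F i).prod (F j)) ∂(Measure.pi F) := by
  have hmp := measurePreserving_updatePair (F := F) i j
  have hi := hmp.integrable_comp_of_integrable hf
  refine ⟨hi.integral_prod_left, ?_⟩
  have h := integral_map hmp.measurable.aemeasurable (f := f) (by rw [hmp.map_eq]; exact hf.1)
  rw [hmp.map_eq] at h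
  exact h.trans (integral_prod _ hi)

theorem ae_pi_of_forall {p : ι → ℝ → Prop} (hp : ∀ i, ∀ᵐ x ∂(F i), p i x) :
    ∀ᵐ v ∂(Measure.pi F), ∀ i, p i (v i) :=
  ae_all_iff.mpr fun i => (measurePreserving_eval F i).quasiMeasurePreserving.ae (hp i)

theorem ae_pi_ne [∀ i, NullSingletonClass (F i)] :
    ∀ᵐ v ∂(Measure.pi F), ∀ i j, i ≠ j → v i ≠ v j := by
  refine ae_all_iff.mpr fun i => ae_all_iff.mpr fun j => ?_
  by_cases hij : i = j
  · exact Filter.Eventually.of_forall fun v h => absurd hij h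
  have hm : MeasurableSet {v : ι → ℝ | v i ≠ v j} :=
    (measurableSet_eq_fun (measurable_pi_apply i) (measurable_pi_apply j)).compl
  have hmp := measurePreserving_updatePair (F := F) i j
  have : ∀ᵐ v ∂(Measure.pi F), v i ≠ v j := by
    rw [← hmp.map_eq, ae_map_iff hmp.measurable.aemeasurable hm]
    have h2 : ∀ᵐ q ∂((Measure.pi F).prod ((F i).prod (F j))), q.2.1 ≠ q.2.2 :=
      Measure.quasiMeasurePreserving_snd.ae (ae_prod_ne (μ := F i) (ν := F j))
    filter_upwards [h2] with q hq
    simpa [updatePair, Function.update_of_ne hij] using hq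
  filter_upwards [this] with v hv _ using hv

theorem highestOutside_updatePair {T : Finset ι} {i j : ι} (hi : i ∈ T) (hj : j ∈ T) (v : ι → ℝ)
    (y z : ℝ) : highestOutside T (updatePair i j v y z) = highestOutside T v := by
  unfold highestOutside
  congr 1
  refine Finset.sup_congr rfl fun l hl => ?_
  have hl' := Finset.mem_compl.mp hl
  have hli : l ≠ i := fun h => hl' (h ▸ hi)
  have hlj : l ≠ j := fun h => hl' (h ▸ hj)
  simp [updatePair, hli, hlj]

/-! ### Normalized truthful mechanisms -/

/-- A mechanism that is truthful at value profiles in the box and whose payments are nonnegative. -/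
structure IsNormalized (M : DirectMechanism ι) (B : ℝ) : Prop where
  measurable_alloc : Measurable M.alloc
  measurable_pay : Measurable M.pay
  feasible : M.IsFeasible B
  dsic : M.IsDSIC B
  ir : M.IsIR B
  pay_nonneg : ∀ v ∈ valueBox ι B, ∀ i, 0 ≤ M.pay v i

/-- The mechanism in which nobody is paid for bidding zero. -/
noncomputable def normalizeAtZero (M : DirectMechanism ι) : DirectMechanism ι where
  alloc := M.alloc
  pay v i := M.pay v i - M.pay (Function.update v i 0) i

theorem update_mem_valueBox {B : ℝ} {v : ι → ℝ} (hv : v ∈ valueBox ι B) (i : ι) {b : ℝ}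
    (hb : b ∈ Set.Icc 0 B) : Function.update v i b ∈ valueBox ι B := by
  intro l
  rcases eq_or_ne l i with rfl | hl
  · simpa using hb
  · simpa [hl] using hv l

theorem isNormalized_normalizeAtZero {M : DirectMechanism ι} {B : ℝ} (hB : 0 ≤ B)
    (hM : M.IsTruthful F B) : IsNormalized (normalizeAtZero M) B where
  measurable_alloc := hM.measurable_alloc
  measurable_pay := by
    refine measurable_pi_lambda _ fun i => ?_
    have h1 : Measurable fun v => M.pay v i := (measurable_pi_apply i).comp hM.measurable_pay
    have h2 : Measurable fun v : ι → ℝ => Function.update v i (0 : ℝ) :=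
      measurable_update'.comp (measurable_id.prodMk measurable_const)
    exact h1.sub (h1.comp h2)
  feasible := hM.feasible
  dsic v hv i b hb := by
    have := hM.dsic v hv i b hb
    simp only [normalizeAtZero, Function.update_idem]
    linarith
  ir v hv i := by
    have h1 := hM.dsic v hv i 0 ⟨le_rfl, hB⟩
    have h2 := (hM.feasible _ (update_mem_valueBox hv i ⟨le_rfl, hB⟩)).1 i
    have h3 := mul_nonneg (hv i).1 h2
    simp only [normalizeAtZero]
    linarith
  pay_nonneg v hv i := by
    have h0 := update_mem_valueBox hv i ⟨le_rfl, hB⟩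
    have h1 := hM.dsic _ h0 i (v i) (hv i)
    rw [Function.update_idem, Function.update_eq_self, Function.update_self] at h1
    simp only [normalizeAtZero]
    linarith

theorem totalPayment_le_normalizeAtZero {M : DirectMechanism ι} {B : ℝ} (hB : 0 ≤ B)
    (hM : M.IsTruthful F B) {v : ι → ℝ} (hv : v ∈ valueBox ι B) :
    M.totalPayment v ≤ (normalizeAtZero M).totalPayment v := by
  refine Finset.sum_le_sum fun i _ => ?_
  have := hM.ir _ (update_mem_valueBox hv i ⟨le_rfl, hB⟩) i
  rw [Function.update_self, zero_mul] at this
  simp only [normalizeAtZero]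
  linarith

namespace IsNormalized

variable {M : DirectMechanism ι} {B : ℝ} (hM : IsNormalized M B)

include hM

theorem pay_le {v : ι → ℝ} (hv : v ∈ valueBox ι B) (i : ι) : M.pay v i ≤ v i * M.alloc v i := by
  linarith [hM.ir v hv i]

theorem alloc_le_one {v : ι → ℝ} (hv : v ∈ valueBox ι B) (i : ι) : M.alloc v i ≤ 1 :=
  (Finset.single_le_sum (fun l _ => (hM.feasible v hv).1 l) (Finset.mem_univ i)).trans
    (hM.feasible v hv).2

theorem isTruthfulRule {v : ι → ℝ} (hv : v ∈ valueBox ι B) (i : ι) :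
    IsTruthfulRule B (fun b => M.alloc (Function.update v i b) i)
      fun b => M.pay (Function.update v i b) i where
  nonneg b hb := (hM.feasible _ (update_mem_valueBox hv i hb)).1 i
  le_one b hb := hM.alloc_le_one (update_mem_valueBox hv i hb) i
  ic b hb b' hb' := by
    have := hM.dsic _ (update_mem_valueBox hv i hb) i b' hb'
    simpa using this
  ir b hb := by simpa using hM.ir _ (update_mem_valueBox hv i hb) i

/-- The bidders other than `i` and `j` pay at most `c` times their probability of winning. -/
theorem totalPayment_le {v : ι → ℝ} (hv : v ∈ valueBox ι B) {i j : ι} (hij : i ≠ j) {c : ℝ}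
    (hc : ∀ l, l ∉ ({i, j} : Finset ι) → v l ≤ c) (hc0 : 0 ≤ c) :
    M.totalPayment v
      ≤ M.pay v i + M.pay v j + c * (1 - M.alloc v i - M.alloc v j) := by
  have hsplit : ∀ f : ι → ℝ, ∑ l, f l = f i + f j + ∑ l ∈ ({i, j} : Finset ι)ᶜ, f l := by
    intro f
    rw [← Finset.sum_add_sum_compl ({i, j} : Finset ι) f, Finset.sum_pair hij]
  have hfeas := hM.feasible v hv
  have h1 : ∑ l ∈ ({i, j} : Finset ι)ᶜ, M.pay v l
      ≤ ∑ l ∈ ({i, j} : Finset ι)ᶜ, c * M.alloc v l :=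
    Finset.sum_le_sum fun l hl => (hM.pay_le hv l).trans
      (mul_le_mul_of_nonneg_right (hc l (Finset.mem_compl.mp hl)) (hfeas.1 l))
  have h2 := hfeas.2
  rw [hsplit] at h2
  rw [← Finset.mul_sum] at h1
  rw [DirectMechanism.totalPayment, hsplit]
  nlinarith

theorem totalPayment_mem_Icc (hB : 0 ≤ B) {v : ι → ℝ} (hv : v ∈ valueBox ι B) :
    M.totalPayment v ∈ Set.Icc 0 B := by
  refine ⟨Finset.sum_nonneg fun i _ => hM.pay_nonneg v hv i, ?_⟩
  calc M.totalPayment v ≤ ∑ i, B * M.alloc v i := Finset.sum_le_sum fun i _ =>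
        (hM.pay_le hv i).trans (mul_le_mul_of_nonneg_right (hv i).2 ((hM.feasible v hv).1 i))
    _ = B * ∑ i, M.alloc v i := by rw [Finset.mul_sum]
    _ ≤ B := by nlinarith [(hM.feasible v hv).2]

theorem measurable_totalPayment : Measurable M.totalPayment :=
  Finset.measurable_sum _ fun i _ => (measurable_pi_apply i).comp hM.measurable_pay

end IsNormalized

end

/-! ### The guarantee -/

section

variable {ι : Type*} [Fintype ι] [DecidableEq ι] {F : ι → Measure ℝ}
  [∀ i, IsProbabilityMeasure (F i)] [∀ i, NullSingletonClass (F i)] {B : ℝ}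

/-- The value profiles at which the bidders in `T` have higher values than all others. -/
def topSet (T : Finset ι) : Set (ι → ℝ) := {v | ∀ i ∈ T, highestOutside T v < v i}

theorem measurableSet_topSet (T : Finset ι) : MeasurableSet (topSet T) := by
  have : topSet T = ⋂ i ∈ T, {v | highestOutside T v < v i} := by
    ext v
    simp [topSet]
  rw [this]
  exact Finset.measurableSet_biInter _ fun i _ =>
    measurableSet_lt (measurable_highestOutside T) (measurable_pi_apply i)

theorem disjoint_topSet {T T' : Finset ι} (hT : T.card = 2) (hT' : T'.card = 2) (hne : T ≠ T') :
    Disjoint (topSet T) (topSet T') := by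
  refine Set.disjoint_left.mpr fun v hv hv' => ?_
  obtain ⟨i, hi, hi'⟩ := Finset.not_subset.mp
    fun h => hne (Finset.eq_of_subset_of_card_le h (hT'.trans hT.symm).le)
  obtain ⟨l, hl', hl⟩ := Finset.not_subset.mp
    fun h => hne (Finset.eq_of_subset_of_card_le h (hT.trans hT'.symm).le).symm
  linarith [hv i hi, hv' l hl', le_highestOutside v hi', le_highestOutside v hl]

theorem exists_mem_topSet (hι : 2 ≤ Fintype.card ι) {v : ι → ℝ} (hpos : ∀ i, 0 < v i)
    (hne : ∀ i j, i ≠ j → v i ≠ v j) : ∃ T : Finset ι, T.card = 2 ∧ v ∈ topSet T := by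
  have hu : (Finset.univ : Finset ι).Nonempty :=
    Finset.card_pos.mp (by rw [Finset.card_univ]; omega)
  obtain ⟨i, -, hi⟩ := Finset.exists_max_image Finset.univ v hu
  have he : (Finset.univ.erase i).Nonempty := Finset.card_pos.mp (by
    rw [Finset.card_erase_of_mem (Finset.mem_univ i), Finset.card_univ]; omega)
  obtain ⟨j, hj, hjmax⟩ := Finset.exists_max_image (Finset.univ.erase i) v he
  have hij : i ≠ j := (Finset.ne_of_mem_erase hj).symm
  refine ⟨{i, j}, Finset.card_pair hij, ?_⟩
  have hlt : highestOutside {i, j} v < v j := by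
    have hle : (({i, j} : Finset ι)ᶜ.sup fun l => (v l).toNNReal) < (v j).toNNReal := by
      refine (Finset.sup_lt_iff (by simpa using hpos j)).mpr fun l hl => ?_
      simp only [Finset.mem_compl, Finset.mem_insert, Finset.mem_singleton, not_or] at hl
      exact (Real.toNNReal_lt_toNNReal_iff (hpos j)).mpr
        ((hjmax l (Finset.mem_erase.mpr ⟨hl.1, Finset.mem_univ l⟩)).lt_of_ne (hne l j hl.2))
    exact (NNReal.coe_lt_coe.mpr hle).trans_eq (Real.coe_toNNReal _ (hpos j).le)
  intro k hk
  rcases Finset.mem_insert.mp hk with rfl | hk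
  · exact hlt.trans_le (hi j (Finset.mem_univ j))
  · rw [Finset.mem_singleton.mp hk]
    exact hlt

theorem ae_mem_valueBox (hF : ∀ i, F i (Set.Icc 0 B)ᶜ = 0) :
    ∀ᵐ v ∂(Measure.pi F), v ∈ valueBox ι B :=
  ae_pi_of_forall fun i => ae_mem_Icc (hF i)

theorem ae_pos (hF : ∀ i, F i (Set.Icc 0 B)ᶜ = 0) : ∀ᵐ v ∂(Measure.pi F), ∀ i, 0 < v i := by
  refine ae_pi_of_forall (p := fun _ x => 0 < x) fun i => ?_
  have hne : ∀ᵐ x ∂(F i), x ≠ 0 := by simp [ae_iff]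
  filter_upwards [ae_mem_Icc (hF i), hne] with x hx h0 using hx.1.lt_of_ne' h0

theorem updatePair_mem_valueBox {v : ι → ℝ} (hv : v ∈ valueBox ι B) (i j : ι) {y z : ℝ}
    (hy : y ∈ Set.Icc 0 B) (hz : z ∈ Set.Icc 0 B) : updatePair i j v y z ∈ valueBox ι B :=
  update_mem_valueBox (update_mem_valueBox hv i hy) j hz

theorem integrable_pi_of_bound (hF : ∀ i, F i (Set.Icc 0 B)ᶜ = 0) {f : (ι → ℝ) → ℝ}
    (hf : Measurable f) {C : ℝ} (hC : ∀ v ∈ valueBox ι B, |f v| ≤ C) :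
    Integrable f (Measure.pi F) :=
  Integrable.of_bound (C := C) hf.aestronglyMeasurable (by
    filter_upwards [ae_mem_valueBox hF] with v hv using hC v hv)

theorem twoBidderRevenue_mem_Icc {i j : ι} (hF : ∀ i, F i (Set.Icc 0 B)ᶜ = 0) {a b y z : ℝ}
    (ha : 0 ≤ a) (hy : y ∈ Set.Icc 0 B) (hz : z ∈ Set.Icc 0 B) :
    twoBidderRevenue (F i) (F j) a b y z ∈ Set.Icc 0 B := by
  unfold twoBidderRevenue
  split_ifs
  · exact pairRevenue_mem_Icc (hF i) ha hz hy
  · exact pairRevenue_mem_Icc (hF j) ha hy hz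

theorem measurable_twoBidderRevenue {i j : ι} (hF : ∀ i, F i (Set.Icc 0 B)ᶜ = 0)
    {a b y z : (ι → ℝ) → ℝ} (ha : Measurable a) (hb : Measurable b) (hy : Measurable y)
    (hz : Measurable z) :
    Measurable fun v => twoBidderRevenue (F i) (F j) (a v) (b v) (y v) (z v) :=
  Measurable.ite (measurableSet_lt hz hy)
    ((measurable_pairRevenue (measurable_lastPrice (hF i))).comp
      (ha.prodMk (hb.prodMk (hy.prodMk hz))))
    ((measurable_pairRevenue (measurable_lastPrice (hF j))).comp
      (ha.prodMk (hb.prodMk (hz.prodMk hy))))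

theorem updatePair_mem_topSet_iff {T : Finset ι} {i j : ι} (hij : i ≠ j) (hT : T = {i, j})
    (v : ι → ℝ) (y z : ℝ) :
    updatePair i j v y z ∈ topSet T ↔ highestOutside T v < y ∧ highestOutside T v < z := by
  have h1 : updatePair i j v y z i = y := by simp [updatePair, hij]
  have h2 : updatePair i j v y z j = z := by simp [updatePair]
  rw [topSet, Set.mem_ofPred_eq, highestOutside_updatePair (by simp [hT]) (by simp [hT])]
  generalize highestOutside T v = c
  simp [hT, h1, h2]

/-- On the event that `T` consists of the two bidders with the highest values, the payments of the
auction agree with a bounded measurable function, whose integral can be computed by resampling the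
values of these two bidders. -/
theorem exists_totalPayment_eq_on_topSet (hF : ∀ i, F i (Set.Icc 0 B)ᶜ = 0) {T : Finset ι} {i j : ι}
    (hij : i ≠ j) (hT : T = {i, j})
    (hpool : ∀ c, activePool F T c = pairPool (F i) (F j) c) :
    Integrable ((topSet T).indicator (poolingAuction hF).toMechanism.totalPayment)
        (Measure.pi F) ∧
      ∃ f : (ι → ℝ) → ℝ, Integrable f (Measure.pi F) ∧
        (topSet T).indicator (poolingAuction hF).toMechanism.totalPayment =ᵐ[Measure.pi F] f ∧
        ∀ v y z, f (updatePair i j v y z)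
          = {q : ℝ × ℝ | highestOutside T v < q.1 ∧ highestOutside T v < q.2}.indicator
            (fun q => twoBidderRevenue (F i) (F j) (pairPool (F i) (F j) (highestOutside T v)).1
              (pairPool (F i) (F j) (highestOutside T v)).2 q.1 q.2) (y, z) := by
  have hTcard : T.card = 2 := hT ▸ Finset.card_pair hij
  have hiT : i ∈ T := by simp [hT]
  have hjT : j ∈ T := by simp [hT]
  have hmpool := (measurable_pairPool (hF i) (hF j)).comp (measurable_highestOutside T)
  have hmem := pairPool_mem (hF i) (hF j)
  set g : (ι → ℝ) → ℝ := fun v =>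
    twoBidderRevenue (F i) (F j) (pairPool (F i) (F j) (highestOutside T v)).1
      (pairPool (F i) (F j) (highestOutside T v)).2 (v i) (v j) with hg
  have hgm : Measurable g := measurable_twoBidderRevenue hF hmpool.fst hmpool.snd
    (measurable_pi_apply i) (measurable_pi_apply j)
  have hgi : Integrable ((topSet T).indicator g) (Measure.pi F) := by
    refine (integrable_pi_of_bound (C := B) hF hgm fun v hv => ?_).indicator
      (measurableSet_topSet T)
    have := twoBidderRevenue_mem_Icc (i := i) (j := j) hF
      (b := (pairPool (F i) (F j) (highestOutside T v)).2)
      ((highestOutside_nonneg T v).trans (hmem _).1) (hv i) (hv j)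
    rw [abs_of_nonneg this.1]
    exact this.2
  have hae : (topSet T).indicator (poolingAuction hF).toMechanism.totalPayment
      =ᵐ[Measure.pi F] (topSet T).indicator g := by
    filter_upwards [ae_mem_valueBox hF, ae_pi_ne] with v hv hne
    by_cases hvT : v ∈ topSet T
    · rw [Set.indicator_of_mem hvT, Set.indicator_of_mem hvT,
        totalPayment_poolingAuction hF hTcard (fun l => (hv l).1) hvT hT (hne i j hij)
          (by rw [hpool]; exact (hmem _).1), hpool]
    · rw [Set.indicator_of_notMem hvT, Set.indicator_of_notMem hvT]
  refine ⟨hgi.congr hae.symm, (topSet T).indicator g, hgi, hae, fun v y z => ?_⟩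
  have h1 : updatePair i j v y z i = y := by simp [updatePair, hij]
  have h2 : updatePair i j v y z j = z := by simp [updatePair]
  classical
  simp only [Set.indicator_apply, hg, updatePair_mem_topSet_iff hij hT,
    highestOutside_updatePair hiT hjT, h1, h2, Set.mem_ofPred_eq]

theorem setIntegral_topSet_le (hF : ∀ i, F i (Set.Icc 0 B)ᶜ = 0) {M : DirectMechanism ι}
    (hM : IsNormalized M B) (hB : 0 ≤ B) {T : Finset ι} (hTcard : T.card = 2) :
    4 / 7 * ∫ v in topSet T, M.totalPayment v ∂(Measure.pi F)
      ≤ ∫ v in topSet T, (poolingAuction hF).toMechanism.totalPayment v ∂(Measure.pi F) := by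
  obtain ⟨i, j, hij, hT, hpool⟩ := exists_activePool_eq F hTcard
  have hiT : i ∈ T := by simp [hT]
  have hjT : j ∈ T := by simp [hT]
  obtain ⟨-, f, hfi, hae, hf⟩ := exists_totalPayment_eq_on_topSet hF hij hT hpool
  have hG := measurableSet_topSet T
  have hMi : Integrable ((topSet T).indicator M.totalPayment) (Measure.pi F) :=
    (integrable_pi_of_bound (C := B) hF hM.measurable_totalPayment fun v hv => by
      have := hM.totalPayment_mem_Icc hB hv
      rw [abs_of_nonneg this.1]
      exact this.2).indicator hG
  obtain ⟨i1, e1⟩ := integral_pi_eq_updatePair i j hMi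
  obtain ⟨i2, e2⟩ := integral_pi_eq_updatePair i j hfi
  rw [← integral_indicator hG, ← integral_indicator hG, integral_congr_ae hae, e1, e2,
    ← integral_const_mul]
  refine integral_mono_ae (i1.const_mul _) i2 ?_
  filter_upwards [ae_mem_valueBox hF] with v hv
  have hc : highestOutside T v ∈ Set.Icc 0 B :=
    ⟨highestOutside_nonneg T v, highestOutside_le hB fun l _ => (hv l).2⟩
  have hu : Measurable fun q : ℝ × ℝ => updatePair i j v q.1 q.2 :=
    (measurable_updatePair i j).comp (measurable_const.prodMk measurable_id)
  have hMind : ∀ q : ℝ × ℝ, (topSet T).indicator M.totalPayment (updatePair i j v q.1 q.2)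
      = {q : ℝ × ℝ | highestOutside T v < q.1 ∧ highestOutside T v < q.2}.indicator
        (fun q => M.totalPayment (updatePair i j v q.1 q.2)) q := by
    classical
    intro q
    simp only [Set.indicator_apply, updatePair_mem_topSet_iff hij hT, Set.mem_ofPred_eq]
  have hfq : ∀ q : ℝ × ℝ, f (updatePair i j v q.1 q.2) = _ := fun q => hf v q.1 q.2
  simp only [hMind, hfq]
  have hbox : ∀ y ∈ Set.Icc 0 B, ∀ z ∈ Set.Icc 0 B, updatePair i j v y z ∈ valueBox ι B :=
    fun y hy z hz => updatePair_mem_valueBox hv i j hy hz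
  have hcomm : ∀ y z, updatePair i j v y z = Function.update (Function.update v j z) i y :=
    fun y z => Function.update_comm hij _ _ _
  have ma : ∀ l, Measurable fun q : ℝ × ℝ => M.alloc (updatePair i j v q.1 q.2) l := fun l =>
    (measurable_pi_apply l).comp (hM.measurable_alloc.comp hu)
  have mp : ∀ l, Measurable fun q : ℝ × ℝ => M.pay (updatePair i j v q.1 q.2) l := fun l =>
    (measurable_pi_apply l).comp (hM.measurable_pay.comp hu)
  refine integral_totalPayment_le_twoBidderRevenue (hF i) (hF j) hc
    (X := fun y z => M.alloc (updatePair i j v y z) i)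
    (Y := fun y z => M.alloc (updatePair i j v y z) j)
    (P := fun y z => M.pay (updatePair i j v y z) i)
    (R := fun y z => M.pay (updatePair i j v y z) j)
    (T := fun y z => M.totalPayment (updatePair i j v y z))
    (ma i) (ma j) (mp i) (mp j) ?_ ?_ ?_ ?_ ?_ ?_ ?_
  · intro z hz
    simpa only [hcomm] using hM.isTruthfulRule (update_mem_valueBox hv j hz) i
  · intro y hy
    exact hM.isTruthfulRule (update_mem_valueBox hv i hy) j
  · intro y hy z hz
    have hfe := hM.feasible _ (hbox y hy z hz)
    refine le_trans ?_ hfe.2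
    rw [← Finset.sum_pair (f := M.alloc (updatePair i j v y z)) hij]
    exact Finset.sum_le_univ_sum_of_nonneg hfe.1
  · exact fun y hy z hz => hM.pay_nonneg _ (hbox y hy z hz) i
  · exact fun y hy z hz => hM.pay_nonneg _ (hbox y hy z hz) j
  · refine integrable_prod_of_bound (C := B) (hF i) (hF j) (hM.measurable_totalPayment.comp hu)
      fun y hy z hz => ?_
    have := hM.totalPayment_mem_Icc hB (hbox y hy z hz)
    simp only
    rw [abs_of_nonneg this.1]
    exact this.2
  · intro y hy z hz _ _
    refine hM.totalPayment_le (hbox y hy z hz) hij (fun l hl => ?_) hc.1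
    rw [← highestOutside_updatePair hiT hjT v y z]
    exact le_highestOutside _ (hT ▸ hl)

theorem iUnion_topSet_ae_eq_univ (hF : ∀ i, F i (Set.Icc 0 B)ᶜ = 0) (hι : 2 ≤ Fintype.card ι) :
    (⋃ T ∈ Finset.powersetCard 2 (Finset.univ : Finset ι), topSet T) =ᵐ[Measure.pi F] Set.univ := by
  refine Filter.eventuallyEq_univ.mpr ?_
  filter_upwards [ae_pos hF, ae_pi_ne] with v hpos hne
  obtain ⟨T, hT, hv⟩ := exists_mem_topSet hι hpos hne
  exact Set.mem_biUnion (Finset.mem_powersetCard.mpr ⟨Finset.subset_univ T, hT⟩) hv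

theorem integral_eq_sum_topSet (hF : ∀ i, F i (Set.Icc 0 B)ᶜ = 0) (hι : 2 ≤ Fintype.card ι)
    {f : (ι → ℝ) → ℝ} (hf : ∀ T : Finset ι, T.card = 2 → IntegrableOn f (topSet T) (Measure.pi F)) :
    Integrable f (Measure.pi F) ∧ ∫ v, f v ∂(Measure.pi F)
      = ∑ T ∈ Finset.powersetCard 2 (Finset.univ : Finset ι),
          ∫ v in topSet T, f v ∂(Measure.pi F) := by
  have hu := iUnion_topSet_ae_eq_univ hF hι
  have hf' : ∀ T ∈ Finset.powersetCard 2 (Finset.univ : Finset ι),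
      IntegrableOn f (topSet T) (Measure.pi F) :=
    fun T hT => hf T (Finset.mem_powersetCard.mp hT).2
  constructor
  · rw [← integrableOn_univ]
    exact ((integrableOn_finset_iUnion.mpr hf')).congr_set_ae hu.symm
  · rw [← setIntegral_univ, ← setIntegral_congr_set hu]
    exact integral_biUnion_finset _ (fun T _ => measurableSet_topSet T)
      (fun T hT T' hT' hne => disjoint_topSet (Finset.mem_powersetCard.mp hT).2
        (Finset.mem_powersetCard.mp hT').2 hne) hf'

theorem poolingAuction_guarantee (hF : ∀ i, F i (Set.Icc 0 B)ᶜ = 0) (hι : 2 ≤ Fintype.card ι) :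
    Integrable (poolingAuction hF).toMechanism.totalPayment (Measure.pi F) ∧
      ∀ M : DirectMechanism ι, IsNormalized M B → 0 ≤ B →
        4 / 7 * M.revenue F ≤ (poolingAuction hF).toMechanism.revenue F := by
  have hA := integral_eq_sum_topSet hF hι
    (f := (poolingAuction hF).toMechanism.totalPayment) fun T hTcard => by
      obtain ⟨i, j, hij, hT, hpool⟩ := exists_activePool_eq F hTcard
      exact (integrable_indicator_iff (measurableSet_topSet T)).mp
        (exists_totalPayment_eq_on_topSet hF hij hT hpool).1
  refine ⟨hA.1, fun M hM hB => ?_⟩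
  have hMi : Integrable M.totalPayment (Measure.pi F) :=
    integrable_pi_of_bound (C := B) hF hM.measurable_totalPayment fun v hv => by
      have := hM.totalPayment_mem_Icc hB hv
      rw [abs_of_nonneg this.1]
      exact this.2
  have h := integral_eq_sum_topSet hF hι (f := M.totalPayment) fun T _ => hMi.integrableOn
  rw [DirectMechanism.revenue, DirectMechanism.revenue, hA.2, h.2, Finset.mul_sum]
  exact Finset.sum_le_sum fun T hT =>
    setIntegral_topSet_le hF hM hB (Finset.mem_powersetCard.mp hT).2

/-- A single bidder is offered the item at once, and no truthful mechanism beats the best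
posted price. -/
theorem poolingAuction_guarantee_of_unique (hF : ∀ i, F i (Set.Icc 0 B)ᶜ = 0) (i : ι)
    (hi : ∀ l, l = i) :
    Integrable (poolingAuction hF).toMechanism.totalPayment (Measure.pi F) ∧
      ∀ M : DirectMechanism ι, IsNormalized M B → 0 ≤ B →
        4 / 7 * M.revenue F ≤ (poolingAuction hF).toMechanism.revenue F := by
  set p := lastPrice (F i) 0 with hp
  have hp' : p = bestPrice (F i) 0 0 := lastPrice_of_nonneg le_rfl
  have hmp := measurePreserving_eval F i
  have huniv : (Finset.univ : Finset ι) = {i} := by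
    ext l
    simp [hi l]
  have hae : (poolingAuction hF).toMechanism.totalPayment
      =ᵐ[Measure.pi F] fun v => (Set.Ici p).indicator (fun _ => p) (v i) := by
    filter_upwards [ae_mem_valueBox hF] with v hv
    have hat : LAP.atLeast v Finset.univ 0 = {i} := by
      rw [huniv]
      simp [LAP.atLeast, Finset.filter_singleton, (hv i).1]
    simp only [DirectMechanism.totalPayment, LAP.toMechanism, hat, LAP.run_singleton]
    rw [sum_pay_postedPrice, Set.indicator_apply]
    rfl
  have hInt : ∀ f : ℝ → ℝ, Integrable f (F i) →
      ∫ v, f (v i) ∂(Measure.pi F) = ∫ x, f x ∂(F i) := by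
    intro f hf
    have h := integral_map hmp.measurable.aemeasurable (f := f) (by rw [hmp.map_eq]; exact hf.1)
    rw [hmp.map_eq] at h
    exact h.symm
  have hind : Integrable ((Set.Ici p).indicator fun _ => p) (F i) :=
    (integrable_const p).indicator measurableSet_Ici
  have hA : (poolingAuction hF).toMechanism.revenue F = topRevenue (F i) 0 := by
    rw [DirectMechanism.revenue, integral_congr_ae hae, hInt _ hind,
      integral_indicator_const _ measurableSet_Ici, topRevenue, ← hp', survival, smul_eq_mul,
      mul_comm]
  refine ⟨(hmp.integrable_comp_of_integrable hind).congr hae.symm, fun M hM hB => ?_⟩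
  have h0 : (0 : ι → ℝ) ∈ valueBox ι B := fun _ => ⟨le_rfl, hB⟩
  have hrule := hM.isTruthfulRule h0 i
  have hupd : ∀ v : ι → ℝ, Function.update (0 : ι → ℝ) i (v i) = v := by
    intro v
    funext l
    rw [hi l, Function.update_self]
  have hMv : ∀ v, M.totalPayment v = M.pay (Function.update (0 : ι → ℝ) i (v i)) i := by
    intro v
    rw [hupd, DirectMechanism.totalPayment, huniv, Finset.sum_singleton]
  have hmeas : Measurable fun b : ℝ => M.pay (Function.update (0 : ι → ℝ) i b) i :=
    (measurable_pi_apply i).comp (hM.measurable_pay.comp (measurable_update (0 : ι → ℝ) (a := i)))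
  have hpi : Integrable (fun b : ℝ => M.pay (Function.update (0 : ι → ℝ) i b) i) (F i) := by
    refine Integrable.of_bound (C := B) hmeas.aestronglyMeasurable ?_
    filter_upwards [ae_mem_Icc (hF i)] with b hb
    simpa using hrule.abs_pay_sub_le
      (fun v hv => hM.pay_nonneg _ (update_mem_valueBox h0 i hv) i) hb ⟨le_rfl, hB⟩
  have hle := hrule.integral_le_topExcess (hF i) ⟨le_rfl, hB⟩ (by simpa using hpi)
  simp only [zero_mul, sub_zero] at hle
  have hIoi : ∫ b in Set.Ioi 0, M.pay (Function.update (0 : ι → ℝ) i b) i ∂(F i)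
      = ∫ b, M.pay (Function.update (0 : ι → ℝ) i b) i ∂(F i) := by
    rw [setIntegral_congr_set Ioi_ae_eq_Ici]
    refine setIntegral_eq_integral_of_ae_compl_eq_zero ?_
    filter_upwards [ae_mem_Icc (hF i)] with b hb hb'
    exact absurd hb.1 hb'
  have hrev : M.revenue F ≤ topExcess (F i) 0 := by
    rw [DirectMechanism.revenue, integral_congr_ae (Filter.Eventually.of_forall hMv), hInt _ hpi,
      ← hIoi]
    exact hle
  rw [hA]
  have h1 := topExcess_le_topRevenue (hF i) (le_refl 0)
  have h2 := topRevenue_nonneg (hF i) (le_refl 0)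
  linarith

end

theorem theorem2 {ι : Type*} [Fintype ι] [DecidableEq ι] (B : ℝ) (F : ι → Measure ℝ)
    [∀ i, IsProbabilityMeasure (F i)]
    (hcont : ∀ i x, F i {x} = 0) (hF : ∀ i, F i (Set.Icc 0 B)ᶜ = 0) :
    ∃ A : LAP F,
      Integrable A.toMechanism.totalPayment (Measure.pi F) ∧
      ∀ M : DirectMechanism ι, M.IsTruthful F B →
        (4 / 7 : ℝ) * M.revenue F ≤ A.toMechanism.revenue F := by
  have _ : ∀ i, NullSingletonClass (F i) := fun i => ⟨hcont i⟩
  refine ⟨poolingAuction hF, ?_⟩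
  rcases isEmpty_or_nonempty ι with hι | ⟨⟨i⟩⟩
  · have h0 : ∀ (M : DirectMechanism ι) v, M.totalPayment v = 0 := fun M v => by
      simp [DirectMechanism.totalPayment]
    have h0' : (poolingAuction hF).toMechanism.totalPayment = fun _ => 0 := funext (h0 _)
    refine ⟨h0' ▸ integrable_zero _ _ _, fun M _ => ?_⟩
    simp [DirectMechanism.revenue, h0]
  · have hB := nonneg_of_support (hF i)
    have key : Integrable (poolingAuction hF).toMechanism.totalPayment (Measure.pi F) ∧
        ∀ M : DirectMechanism ι, IsNormalized M B → 0 ≤ B →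
          4 / 7 * M.revenue F ≤ (poolingAuction hF).toMechanism.revenue F := by
      rcases Nat.lt_or_ge (Fintype.card ι) 2 with h | h
      · exact poolingAuction_guarantee_of_unique hF i fun l =>
          Fintype.card_le_one_iff.mp (by omega) l i
      · exact poolingAuction_guarantee hF h
    refine ⟨key.1, fun M hM => le_trans ?_ (key.2 _ (isNormalized_normalizeAtZero hB hM) hB)⟩
    have hN := isNormalized_normalizeAtZero hB hM
    refine mul_le_mul_of_nonneg_left (integral_mono_ae hM.integrable
      (integrable_pi_of_bound (C := B) hF hN.measurable_totalPayment fun v hv => ?_) ?_)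
      (by norm_num)
    · have := hN.totalPayment_mem_Icc hB hv
      rw [abs_of_nonneg this.1]
      exact this.2
    · filter_upwards [ae_mem_valueBox hF] with v hv using totalPayment_le_normalizeAtZero hB hM hv
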